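/- Let $a<b$, $T>0$, $\delta>0$, $\nu>0$ and $k\ge 0$ be fixed. Let $\gamma:\mathbb R\to[0,\infty)$ be even, with $\gamma\in L^1_{\mathrm{loc}}(\mathbb R)$ and $0<\int_{-\delta}^{\delta}s^2\gamma(s)\,ds<\infty$. All functions of $x$ are extended $(b-a)$-periodically to $\mathbb R$. *Exact problem.* $(u,q)$ solves $$u_{tt}-2\int_0^\delta s^2\gamma(s)\,\tfrac1s\big(q(x,t;s)-q(x-s,t;s)\big)\,ds=0\ \text{ on }(a,b)\times(0,T),\qquad q(x,t;s)=\tfrac1s\big(u(x+s,t)-u(x,t)\big)\ \text{ for } s\in(0,\delta],\ t\in[0,T],$$ and is periodic in $x$. *Scheme.* For a partition $a=x_{1/2}<\dots<x_{N+1/2}=b$ into cells $I_j=(x_{j-1/2},x_{j+1/2})$ of lengths $h_j$, let $h=\max_jh_j$ and assume $\nu h\le\min_jh_j$. Let $V_h^k$ be the space of functions that are polynomials of degree at most $k$ on each $I_j$. A semi-discrete DG solution is a pair with $u_h(\cdot,t)\in V_h^k$ and $q_h(\cdot,t;s)\in V_h^k$ for $t\in[0,T]$, $s\in(0,\delta]$,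 where $u_h$ is $C^2$ in $t$, such that for all $v_h,w_h\in V_h^k$ and all $j$ $$\int_{I_j}(u_h)_{tt}v_h\,dx-2\int_0^\delta s^2\gamma(s)\int_{I_j}\tfrac1s\big(q_h(x,t;s)-q_h(x-s,t;s)\big)v_h(x)\,dx\,ds=0\quad(0<t<T),$$ $$\int_{I_j}q_h(x,t;s)w_h\,dx-\int_{I_j}\tfrac1s\big(u_h(x+s,t)-u_h(x,t)\big)w_h(x)\,dx=0\quad(0\le t\le T,\ 0<s\le\delta).$$ The initial data are $u_h(\cdot,0)=P_hu(\cdot,0)$ and $(u_h)_t(\cdot,0)=P_hu_t(\cdot,0)$, where $P_h$ is the $L^2$-projection onto $V_h^k$. Put $e_u=u_h-u$ and $e_q=q_h-q$. **Theorem.** For every $M$ there is a constant $C>0$, depending only on $a,b,T,\nu,k,\gamma,\delta$ and $M$ (in particular not on $h$ or on the partition), such that the following holds. If $u\in C^{k+2}(\mathbb R\times[0,T])$, $|u_t(\cdot,t)|_{H^{k+1}(a,b)}\le M$ for all $t\in[0,T]$ and $|q(\cdot,t;s)|_{H^{k+1}(a,b)}\le M$ for all $t\in[0,T]$ and $s\in(0,\delta]$,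 then for every such partition and every DG solution $(u_h,q_h)$ with these initial data, the function $s\mapsto s^2\gamma(s)\|e_q(\cdot,t;s)\|^2_{L^2(a,b)}$ is integrable on $(0,\delta]$ and $$\tfrac12\|(e_u)_t(\cdot,t)\|_{L^2(a,b)}^2+\int_0^\delta s^2\gamma(s)\,\|e_q(\cdot,t;s)\|_{L^2(a,b)}^2\,ds\le C\,h^{2k+2}\qquad\text{for all }t\in[0,T].$$ -/

import Mathlib

noncomputable section

namespace NonlocalDG

/-- The time derivative on `[0, T]` (one-sided at the two end points) of `f = f(x, t)`. -/
def dt (T : ℝ) (f : ℝ → ℝ → ℝ) (x t : ℝ) : ℝ :=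
  derivWithin (fun τ => f x τ) (Set.Icc 0 T) t

/-- The norm of `L²(a, b)`. -/
def l2Norm (a b : ℝ) (v : ℝ → ℝ) : ℝ :=
  Real.sqrt (∫ x in a..b, (v x) ^ 2)

/-- The seminorm `|v|` of `H^m(a, b)`, for functions `v` of class `C^m`. -/
def hSeminorm (a b : ℝ) (m : ℕ) (v : ℝ → ℝ) : ℝ :=
  l2Norm a b (iteratedDeriv m v)

/-- The radial kernel `γ(x, y) = γ(x - y)` is nonnegative and symmetric, and
`0 < ∫_{-δ}^{δ} s² γ(s) ds < ∞`. -/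
structure KernelCondition (δ : ℝ) (γ : ℝ → ℝ) : Prop where
  nonneg : ∀ s, 0 ≤ γ s
  even : ∀ s, γ (-s) = γ s
  integrable : IntervalIntegrable (fun s => s ^ 2 * γ s) MeasureTheory.volume (-δ) δ
  pos : 0 < ∫ s in (-δ)..δ, s ^ 2 * γ s

/-- `(u, q)` solves the first order reformulation of the nonlocal wave equation on
`(a, b) × (0, T)`, with periodic boundary conditions: the functions of `x` are the
`(b - a)`-periodic ones. -/
structure IsExactSolution (a b T δ : ℝ) (γ : ℝ → ℝ)
    (u : ℝ → ℝ → ℝ) (q : ℝ → ℝ → ℝ → ℝ) : Prop where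
  periodic : ∀ t ∈ Set.Icc 0 T, Function.Periodic (fun x => u x t) (b - a)
  wave : ∀ t ∈ Set.Ioo 0 T, ∀ x ∈ Set.Ioo a b,
    dt T (dt T u) x t
      - 2 * ∫ s in (0 : ℝ)..δ, s ^ 2 * γ s * (1 / s * (q x t s - q (x - s) t s)) = 0
  aux : ∀ t ∈ Set.Icc 0 T, ∀ s ∈ Set.Ioc 0 δ, ∀ x,
    q x t s - 1 / s * (u (x + s) t - u x t) = 0

/-- A partition `a = x_{1/2} < x_{3/2} < ⋯ < x_{N+1/2} = b`. -/
structure Mesh (a b : ℝ) where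
  N : ℕ
  node : Fin (N + 1) → ℝ
  strictMono : StrictMono node
  node_first : node 0 = a
  node_last : node (Fin.last N) = b

namespace Mesh

variable {a b : ℝ}

/-- The left end point of the `j`-th cell. -/
def left (m : Mesh a b) (j : Fin m.N) : ℝ := m.node j.castSucc

/-- The right end point of the `j`-th cell. -/
def right (m : Mesh a b) (j : Fin m.N) : ℝ := m.node j.succ

/-- The `j`-th cell `I_j`. -/
def cell (m : Mesh a b) (j : Fin m.N) : Set ℝ := Set.Ioo (m.left j) (m.right j)

/-- The length `h_j` of the `j`-th cell. -/
def length (m : Mesh a b) (j : Fin m.N) : ℝ := m.right j - m.left j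

/-- The mesh size `h = max_j h_j` (a supremum over a finite set, nonempty when `a < b`). -/
def size (m : Mesh a b) : ℝ := ⨆ j, m.length j

/-- The regularity condition `ν max_j h_j ≤ min_j h_j`. -/
def IsRegular (m : Mesh a b) (ν : ℝ) : Prop := ∀ j, ν * m.size ≤ m.length j

/-- The space `V_h^k` of functions that agree with a polynomial of degree at most `k` on each
(open) cell, extended periodically; the values at the nodes are immaterial. -/
def dgSpace (m : Mesh a b) (k : ℕ) : Set (ℝ → ℝ) :=
  {v | Function.Periodic v (b - a) ∧
    ∀ j, ∃ p : Polynomial ℝ, p.natDegree ≤ k ∧ ∀ x ∈ m.cell j, v x = p.eval x}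

/-- `ℋ_j(v, w; s)`. -/
def opH (m : Mesh a b) (j : Fin m.N) (v w : ℝ → ℝ) (s : ℝ) : ℝ :=
  ∫ x in (m.left j)..(m.right j), 1 / s * (v (x + s) - v x) * w x

/-- `𝒦_j(v, w; s)`. -/
def opK (m : Mesh a b) (j : Fin m.N) (v w : ℝ → ℝ) (s : ℝ) : ℝ :=
  ∫ x in (m.left j)..(m.right j), 1 / s * (v x - v (x - s)) * w x

/-- `w = P_h v`, the `L²` projection of `v` onto `V_h^k`. -/
def IsL2Projection (m : Mesh a b) (k : ℕ) (v w : ℝ → ℝ) : Prop :=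
  w ∈ m.dgSpace k ∧ ∀ j, ∀ p : Polynomial ℝ, p.natDegree ≤ k →
    ∫ x in (m.left j)..(m.right j), (v x - w x) * p.eval x = 0

/-- `(uh, qh)` is a solution on `[0, T]` of the semi-discrete scheme. -/
structure IsDGSolution (m : Mesh a b) (T δ : ℝ) (k : ℕ) (γ : ℝ → ℝ)
    (uh : ℝ → ℝ → ℝ) (qh : ℝ → ℝ → ℝ → ℝ) : Prop where
  mem_u : ∀ t ∈ Set.Icc 0 T, (fun x => uh x t) ∈ m.dgSpace k
  mem_q : ∀ t ∈ Set.Icc 0 T, ∀ s ∈ Set.Ioc 0 δ, (fun x => qh x t s) ∈ m.dgSpace k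
  time_smooth : ∀ j, ∀ x ∈ m.cell j, ContDiffOn ℝ 2 (fun t => uh x t) (Set.Icc 0 T)
  wave : ∀ t ∈ Set.Ioo 0 T, ∀ j, ∀ v ∈ m.dgSpace k,
    (∫ x in (m.left j)..(m.right j), dt T (dt T uh) x t * v x)
      - 2 * ∫ s in (0 : ℝ)..δ, s ^ 2 * γ s * m.opK j (fun x => qh x t s) v s = 0
  aux : ∀ t ∈ Set.Icc 0 T, ∀ s ∈ Set.Ioc 0 δ, ∀ j, ∀ w ∈ m.dgSpace k,
    (∫ x in (m.left j)..(m.right j), qh x t s * w x) - m.opH j (fun x => uh x t) w s = 0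

/-- The initial data of the scheme are the `L²` projections of those of the exact solution. -/
def HasProjectedInitialData (m : Mesh a b) (T : ℝ) (k : ℕ) (u uh : ℝ → ℝ → ℝ) : Prop :=
  m.IsL2Projection k (fun x => u x 0) (fun x => uh x 0) ∧
    ∀ j, ∀ p : Polynomial ℝ, p.natDegree ≤ k →
      ∫ x in (m.left j)..(m.right j), (dt T u x 0 - dt T uh x 0) * p.eval x = 0

end Mesh

end NonlocalDG

end

/-! Local integrability of `γ` makes the nonlocal wave operator bounded on periodic `L²`. It
composes two difference quotients, each of norm at most `2 / s`, and the weight `s² γ(s)` absorbs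
the resulting `s⁻²`. With `G = ∫₀^δ γ < ∞`, the error equation is therefore a second order system
with a bounded right-hand side, uniformly in the mesh. No energy identity is needed.

Let `c(t)` be the coordinates of `e_u` in an `L²`-orthonormal basis of `V_h^k`, so that `‖c‖` is the
norm of the projected error. What the projection misses is an approximation error of order
`h^(k+1)`, by piecewise Taylor-like polynomials and Poincaré's inequality on each cell. The
auxiliary equation says that the projection of `e_q` is the projection of the difference quotient of
`e_u`. Hence `‖e_q(s)‖ ≤ (2 / s) A + B`, with `A` bounding `‖e_u‖` and `B = h^(k+1) M`
(`isControlledFamily_error`). Here `|u|_{H^{k+1}}` has to be controlled by the bound on `q`: letting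
`s → 0` bounds the derivative of order `k + 2`, and periodicity gives back the one of order `k + 1`.

Testing the difference of the two wave equations with the projection of `∂ₜ² e_u` gives `‖c''‖ ≤ 4
(2 A + δ B) G`, that is, a multiple of `‖c‖` plus `O(h^(k+1))` (`norm_acceleration_le`). As `c(0) =
c'(0) = 0`, Grönwall's inequality makes `c` and `c'` of order `h^(k+1)` (`projected_error_le`).
Adding the approximation errors gives the velocity term, and the bound on `‖e_q(s)‖`, weighted by
`s² γ(s)`, gives the other term. -/

namespace NonlocalDG

open MeasureTheory Set Filter Topology

/-! ### Essentially bounded functions: a class stable under products and shifts -/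

section EssentiallyBounded

variable {f g : ℝ → ℝ}

theorem intervalIntegrable_of_memLp_top (hf : MemLp f ⊤ volume) (a b : ℝ) :
    IntervalIntegrable f volume a b := by
  rw [intervalIntegrable_iff]
  have : IsFiniteMeasure (volume.restrict (uIoc a b)) :=
    ⟨by simp [uIoc, Real.volume_Ioc]⟩
  exact (hf.restrict _).integrable le_top

theorem memLp_top_mul (hf : MemLp f ⊤ volume) (hg : MemLp g ⊤ volume) :
    MemLp (fun x => f x * g x) ⊤ volume :=
  hg.mul' hf

theorem memLp_top_sq (hf : MemLp f ⊤ volume) : MemLp (fun x => f x ^ 2) ⊤ volume := by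
  simpa only [pow_two] using memLp_top_mul hf hf

theorem memLp_top_comp_add (hf : MemLp f ⊤ volume) (s : ℝ) :
    MemLp (fun x => f (x + s)) ⊤ volume :=
  hf.comp_measurePreserving (measurePreserving_add_right volume s)

theorem memLp_top_comp_sub (hf : MemLp f ⊤ volume) (s : ℝ) :
    MemLp (fun x => f (x - s)) ⊤ volume :=
  hf.comp_measurePreserving (measurePreserving_sub_right volume s)

theorem memLp_top_of_continuous_periodic {L : ℝ} (hL : 0 < L) (hf : Continuous f)
    (hp : Function.Periodic f L) : MemLp f ⊤ volume := by
  obtain ⟨C, hC⟩ := isCompact_Icc.exists_bound_of_continuousOn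
    (s := Icc 0 L) hf.continuousOn
  refine memLp_top_of_bound hf.aestronglyMeasurable C (.of_forall fun x => ?_)
  obtain ⟨y, hy, hxy⟩ := hp.exists_mem_Ico₀ hL x
  rw [hxy]
  exact hC y (Ico_subset_Icc_self hy)

end EssentiallyBounded

/-! ### Cauchy–Schwarz, periodic shifts and Poincaré's inequality in `L²` -/

section SquareIntegrals

variable {a b : ℝ} {f g : ℝ → ℝ}

/-- The quadratic polynomial `t ↦ ∫ (f + t g)²` is nonnegative, so its discriminant is not positive.
-/
theorem sq_integral_mul_le (hab : a ≤ b)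
    (hf : IntervalIntegrable (fun x => f x ^ 2) volume a b)
    (hg : IntervalIntegrable (fun x => g x ^ 2) volume a b)
    (hfg : IntervalIntegrable (fun x => f x * g x) volume a b) :
    (∫ x in a..b, f x * g x) ^ 2 ≤ (∫ x in a..b, f x ^ 2) * ∫ x in a..b, g x ^ 2 := by
  have key : ∀ t : ℝ, 0 ≤ (∫ x in a..b, g x ^ 2) * (t * t) + (2 * ∫ x in a..b, f x * g x) * t
      + ∫ x in a..b, f x ^ 2 := by
    intro t
    have h : ∫ x in a..b, (f x + t * g x) ^ 2 = (∫ x in a..b, g x ^ 2) * (t * t)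
        + (2 * ∫ x in a..b, f x * g x) * t + ∫ x in a..b, f x ^ 2 := by
      have e : ∀ x, (f x + t * g x) ^ 2 = (t * t) * g x ^ 2 + (2 * t) * (f x * g x) + f x ^ 2 :=
        fun x => by ring
      simp_rw [e]
      rw [intervalIntegral.integral_add ((hg.const_mul _).add (hfg.const_mul _)) hf,
        intervalIntegral.integral_add (hg.const_mul _) (hfg.const_mul _),
        intervalIntegral.integral_const_mul, intervalIntegral.integral_const_mul]
      ring
    rw [← h]
    exact intervalIntegral.integral_nonneg hab fun x _ => sq_nonneg _
  have := discrim_le_zero key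
  rw [discrim] at this
  nlinarith

theorem sq_integral_mul_le_of_memLp_top (hab : a ≤ b) (hf : MemLp f ⊤ volume)
    (hg : MemLp g ⊤ volume) :
    (∫ x in a..b, f x * g x) ^ 2 ≤ (∫ x in a..b, f x ^ 2) * ∫ x in a..b, g x ^ 2 :=
  sq_integral_mul_le hab (intervalIntegrable_of_memLp_top (memLp_top_sq hf) a b)
    (intervalIntegrable_of_memLp_top (memLp_top_sq hg) a b)
    (intervalIntegrable_of_memLp_top (memLp_top_mul hf hg) a b)

theorem integral_comp_add_of_periodic (hf : Function.Periodic f (b - a)) (s : ℝ) :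
    ∫ x in a..b, f (x + s) = ∫ x in a..b, f x := by
  have := hf.intervalIntegral_add_eq (a + s) a
  rw [intervalIntegral.integral_comp_add_right]
  rw [show a + s + (b - a) = b + s by ring, show a + (b - a) = b by ring] at this
  exact this

theorem integral_sub_sq_le (hab : a ≤ b) (hf : MemLp f ⊤ volume) (hg : MemLp g ⊤ volume) :
    ∫ x in a..b, (f x - g x) ^ 2 ≤ 2 * (∫ x in a..b, f x ^ 2) + 2 * ∫ x in a..b, g x ^ 2 := by
  have hf2 := intervalIntegrable_of_memLp_top (memLp_top_sq hf) a b
  have hg2 := intervalIntegrable_of_memLp_top (memLp_top_sq hg) a b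
  rw [← intervalIntegral.integral_const_mul, ← intervalIntegral.integral_const_mul,
    ← intervalIntegral.integral_add (hf2.const_mul _) (hg2.const_mul _)]
  refine intervalIntegral.integral_mono_on hab
    (intervalIntegrable_of_memLp_top (memLp_top_sq (hf.sub hg)) a b)
    ((hf2.const_mul _).add (hg2.const_mul _)) fun x _ => ?_
  nlinarith [sq_nonneg (f x + g x)]

theorem integral_shift_sub_sq_le (hab : a ≤ b) (hf : MemLp f ⊤ volume)
    (hp : Function.Periodic f (b - a)) (s : ℝ) :
    ∫ x in a..b, (f (x + s) - f x) ^ 2 ≤ 4 * ∫ x in a..b, f x ^ 2 := by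
  have h := integral_sub_sq_le hab (memLp_top_comp_add hf s) hf
  have hp2 : Function.Periodic (fun x => f x ^ 2) (b - a) := fun x => by simp [hp x]
  rw [integral_comp_add_of_periodic hp2 s] at h
  linarith

/-- The backward difference quotient is bounded by `2 / s` on `L²`. -/
theorem abs_integral_diffQuotient_mul_le (hab : a ≤ b) (hf : MemLp f ⊤ volume)
    (hp : Function.Periodic f (b - a)) (hg : MemLp g ⊤ volume) {s : ℝ} (hs : 0 < s) :
    |∫ x in a..b, 1 / s * (f x - f (x - s)) * g x|
      ≤ 2 / s * Real.sqrt (∫ x in a..b, f x ^ 2) * Real.sqrt (∫ x in a..b, g x ^ 2) := by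
  have h1 := sq_integral_mul_le_of_memLp_top hab
    (hf.sub (memLp_top_comp_sub hf s)) hg
  have h2 := integral_shift_sub_sq_le hab hf hp (-s)
  have h3 : ∫ x in a..b, (f - fun x => f (x - s)) x ^ 2 = ∫ x in a..b, (f (x + -s) - f x) ^ 2 := by
    congr 1; ext x; simp only [Pi.sub_apply, ← sub_eq_add_neg]; ring
  rw [h3] at h1
  have h4 : (∫ x in a..b, (f x - f (x - s)) * g x) ^ 2
      ≤ (4 * ∫ x in a..b, f x ^ 2) * ∫ x in a..b, g x ^ 2 :=
    h1.trans (mul_le_mul_of_nonneg_right h2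
      (intervalIntegral.integral_nonneg hab fun x _ => sq_nonneg _))
  have e : ∫ x in a..b, 1 / s * (f x - f (x - s)) * g x
      = 1 / s * ∫ x in a..b, (f x - f (x - s)) * g x := by
    rw [← intervalIntegral.integral_const_mul]; congr 1; ext x; ring
  have h5 := Real.abs_le_sqrt h4
  have hF : 0 ≤ ∫ x in a..b, f x ^ 2 :=
    intervalIntegral.integral_nonneg hab fun x _ => sq_nonneg _
  rw [Real.sqrt_mul (by positivity), Real.sqrt_mul (by norm_num),
    show (4 : ℝ) = 2 ^ 2 by norm_num, Real.sqrt_sq (by norm_num)] at h5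
  rw [e, abs_mul, abs_of_pos (by positivity)]
  calc _ ≤ 1 / s * (2 * Real.sqrt (∫ x in a..b, f x ^ 2) * Real.sqrt (∫ x in a..b, g x ^ 2)) :=
        mul_le_mul_of_nonneg_left h5 (by positivity)
    _ = _ := by ring

/-- Poincaré's inequality on `[l, r]` for functions that vanish at `l`. -/
theorem integral_sq_le_of_eq_zero_left {l r : ℝ} (hlr : l ≤ r) {R R' : ℝ → ℝ}
    (hR : ∀ x, HasDerivAt R (R' x) x) (hR' : Continuous R') (h0 : R l = 0) :
    ∫ x in l..r, R x ^ 2 ≤ (r - l) ^ 2 * ∫ x in l..r, R' x ^ 2 := by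
  have hRc : Continuous R := continuous_iff_continuousAt.2 fun x => (hR x).continuousAt
  have hpt : ∀ x ∈ Icc l r, R x ^ 2 ≤ (r - l) * ∫ y in l..r, R' y ^ 2 := by
    intro x hx
    -- The factor `1` is kept so that Cauchy–Schwarz against the constant function yields the length
    -- `x - l`.
    have e : R x = ∫ y in l..x, 1 * R' y := by
      simp only [one_mul]
      rw [intervalIntegral.integral_eq_sub_of_hasDerivAt (fun y _ => hR y)
        (hR'.intervalIntegrable _ _), h0, sub_zero]
    have h1 := sq_integral_mul_le (f := fun _ => (1 : ℝ)) (g := R') hx.1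
      (by simp) ((hR'.pow 2).intervalIntegrable _ _) ((hR'.const_mul 1).intervalIntegrable _ _)
    rw [← e] at h1
    simp only [one_pow, intervalIntegral.integral_const, smul_eq_mul, mul_one] at h1
    have h2 : ∫ y in l..x, R' y ^ 2 ≤ ∫ y in l..r, R' y ^ 2 :=
      intervalIntegral.integral_mono_interval le_rfl hx.1 hx.2
        (.of_forall fun y => sq_nonneg _) ((hR'.pow 2).intervalIntegrable _ _)
    have h3 : 0 ≤ ∫ y in l..x, R' y ^ 2 :=
      intervalIntegral.integral_nonneg hx.1 fun y _ => sq_nonneg _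
    calc R x ^ 2 ≤ _ := h1
      _ ≤ _ := mul_le_mul (by linarith [hx.2]) h2 h3 (by linarith)
  calc ∫ x in l..r, R x ^ 2 ≤ ∫ _ in l..r, (r - l) * ∫ y in l..r, R' y ^ 2 :=
        intervalIntegral.integral_mono_on hlr ((hRc.pow 2).intervalIntegrable _ _) (by simp) hpt
    _ = _ := by simp only [intervalIntegral.integral_const, smul_eq_mul]; ring

end SquareIntegrals

/-! ### Polynomial approximation on one interval -/

section PolynomialApproximation

theorem exists_antiderivative_mem_degreeLT {n : ℕ} {p : Polynomial ℝ}
    (hp : p ∈ Polynomial.degreeLT ℝ n) :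
    ∃ P ∈ Polynomial.degreeLT ℝ (n + 1), P.derivative = p := by
  refine ⟨∑ i ∈ Finset.range n, Polynomial.monomial (i + 1) (p.coeff i / (i + 1)), ?_, ?_⟩
  · refine Submodule.sum_mem _ fun i hi => ?_
    rw [Polynomial.mem_degreeLT]
    refine (Polynomial.degree_monomial_le _ _).trans_lt ?_
    exact_mod_cast Nat.succ_lt_succ (Finset.mem_range.1 hi)
  · rw [Polynomial.mem_degreeLT] at hp
    conv_rhs => rw [Polynomial.as_sum_range' p (n + 1) (by
      rcases eq_or_ne p 0 with rfl | h0
      · simp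
      · exact ((Polynomial.natDegree_lt_iff_degree_lt h0).2 hp).trans (Nat.lt_succ_self n))]
    rw [Finset.sum_range_succ, Polynomial.coeff_eq_zero_of_degree_lt hp, Polynomial.monomial_zero_right,
      add_zero, Polynomial.derivative_sum]
    refine Finset.sum_congr rfl fun i _ => ?_
    rw [Polynomial.derivative_monomial]
    have : ((i : ℝ) + 1) ≠ 0 := by positivity
    congr 1
    push_cast
    simp [div_mul_cancel₀ _ this]

/-- Approximation by polynomials of degree less than `n`, in `L²(l, r)`. -/
theorem exists_polynomial_integral_sq_le {l r : ℝ} (hlr : l ≤ r) (n : ℕ) :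
    ∀ v : ℝ → ℝ, ContDiff ℝ n v → ∃ p ∈ Polynomial.degreeLT ℝ n,
      ∫ x in l..r, (v x - p.eval x) ^ 2
        ≤ (r - l) ^ (2 * n) * ∫ x in l..r, (iteratedDeriv n v x) ^ 2 := by
  induction n with
  | zero =>
    intro v _
    exact ⟨0, Submodule.zero_mem _, by simp⟩
  | succ n ih =>
    intro v hv
    have hv' : ContDiff ℝ n (deriv v) :=
      (contDiff_succ_iff_deriv.1 (by exact_mod_cast hv)).2.2
    have hvd : Differentiable ℝ v := hv.differentiable (by simp)
    obtain ⟨p, hp, hle⟩ := ih (deriv v) hv'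
    obtain ⟨P, hP, hPp⟩ := exists_antiderivative_mem_degreeLT hp
    -- An antiderivative of the approximant of `v'`, with the constant chosen so that the error
    -- vanishes at `l`. Poincaré's inequality then gains a factor `(r - l)²` per derivative.
    refine ⟨P + Polynomial.C (v l - P.eval l), Submodule.add_mem _ hP ?_, ?_⟩
    · rw [Polynomial.mem_degreeLT]
      exact Polynomial.degree_C_le.trans_lt (by exact_mod_cast Nat.succ_pos n)
    · have h1 := integral_sq_le_of_eq_zero_left hlr
        (R := fun x => v x - (P + Polynomial.C (v l - P.eval l)).eval x)
        (R' := fun x => deriv v x - p.eval x)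
        (fun x => by
          have := (P + Polynomial.C (v l - P.eval l)).hasDerivAt x
          rw [Polynomial.derivative_add, Polynomial.derivative_C, add_zero, hPp] at this
          exact (hvd x).hasDerivAt.sub this)
        (hv'.continuous.sub p.continuous) (by simp)
      refine h1.trans ?_
      rw [iteratedDeriv_succ', show 2 * (n + 1) = 2 + 2 * n by ring, pow_add, mul_assoc]
      exact mul_le_mul_of_nonneg_left hle (sq_nonneg _)

end PolynomialApproximation

end NonlocalDG

namespace NonlocalDG

open MeasureTheory Set Filter Topology

theorem mem_degreeLT_succ_iff {k : ℕ} {p : Polynomial ℝ} :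
    p ∈ Polynomial.degreeLT ℝ (k + 1) ↔ p.natDegree ≤ k := by
  rcases eq_or_ne p 0 with rfl | h
  · simp
  · rw [Polynomial.mem_degreeLT, ← Polynomial.natDegree_lt_iff_degree_lt h, Nat.lt_succ_iff]

theorem integral_congr_of_eqOn_Ioo {l r : ℝ} (hlr : l ≤ r) {f g : ℝ → ℝ} (h : EqOn f g (Ioo l r)) :
    ∫ x in l..r, f x = ∫ x in l..r, g x := by
  rw [intervalIntegral.integral_of_le hlr, intervalIntegral.integral_of_le hlr,
    integral_Ioc_eq_integral_Ioo, integral_Ioc_eq_integral_Ioo]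
  exact setIntegral_congr_fun measurableSet_Ioo h

/-! ### Cells, periodic wrapping and the structure of `V_h^k` -/

namespace Mesh

variable {a b : ℝ} (m : Mesh a b)

theorem left_lt_right (j : Fin m.N) : m.left j < m.right j :=
  m.strictMono Fin.castSucc_lt_succ

theorem le_left (j : Fin m.N) : a ≤ m.left j :=
  m.node_first.symm.trans_le (m.strictMono.monotone (Fin.zero_le _))

theorem right_le (j : Fin m.N) : m.right j ≤ b :=
  (m.strictMono.monotone (Fin.le_last _)).trans_eq m.node_last

theorem length_le_size (j : Fin m.N) : m.length j ≤ m.size :=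
  le_ciSup (f := m.length) (Set.finite_range _).bddAbove j

/-- Otherwise induction along the nodes puts every node, and in particular `b`, to the left of `y`.
-/
theorem exists_mem_cell {y : ℝ} (hy : y ∈ Ico a b) (hn : y ∉ range m.node) : ∃ j, y ∈ m.cell j := by
  by_contra! h
  have : ∀ i : Fin (m.N + 1), m.node i < y := by
    intro i
    induction i using Fin.induction with
    | zero =>
      rw [m.node_first]
      exact lt_of_le_of_ne hy.1 fun e => hn ⟨0, by rw [m.node_first, e]⟩
    | succ j ih =>
      rcases lt_trichotomy (m.node j.succ) y with h1 | h1 | h1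
      · exact h1
      · exact absurd ⟨_, h1⟩ hn
      · exact absurd ⟨ih, h1⟩ (h j)
  have h2 := this (Fin.last _)
  rw [m.node_last] at h2
  exact absurd hy.2 h2.le.not_gt

theorem eq_of_mem_cell {i j : Fin m.N} {y : ℝ} (hi : y ∈ m.cell i) (hj : y ∈ m.cell j) : i = j := by
  by_contra hne
  wlog h : i < j generalizing i j
  · exact this hj hi (Ne.symm hne) (lt_of_le_of_ne (not_lt.1 h) (Ne.symm hne))
  have : m.right i ≤ m.left j := m.strictMono.monotone (by
    rw [Fin.le_def]; simpa using h)
  exact absurd (hj.1.trans hi.2) this.not_gt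

theorem sum_integral_cell {f : ℝ → ℝ} (hf : IntervalIntegrable f volume a b) :
    ∑ j, ∫ x in (m.left j)..(m.right j), f x = ∫ x in a..b, f x := by
  have hab : a ≤ b :=
    (m.node_first.symm.trans_le (m.strictMono.monotone (Fin.zero_le _))).trans_eq m.node_last
  let c : ℕ → ℝ := fun i => if h : i < m.N + 1 then m.node ⟨i, h⟩ else b
  have hl : ∀ j : Fin m.N, m.left j = c j := fun j => by
    simp only [c, dif_pos (show (j : ℕ) < m.N + 1 by omega)]; rfl
  have hr : ∀ j : Fin m.N, m.right j = c (j + 1) := fun j => by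
    simp only [c, dif_pos (show (j : ℕ) + 1 < m.N + 1 by omega)]; rfl
  have h0 : c 0 = a := by simp only [c, dif_pos (Nat.succ_pos _), ← m.node_first]; rfl
  have hN : c m.N = b := by simp only [c, dif_pos (Nat.lt_succ_self _), ← m.node_last]; rfl
  have := intervalIntegral.sum_integral_adjacent_intervals (f := f) (μ := volume) (a := c) (n := m.N)
    (fun i hi => by
      have e1 := hl ⟨i, hi⟩
      have e2 := hr ⟨i, hi⟩
      simp only at e1 e2
      rw [← e1, ← e2]
      refine hf.mono_set ?_
      rw [uIcc_of_le hab, uIcc_of_le (m.left_lt_right _).le]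
      exact Icc_subset_Icc (m.le_left _) (m.right_le _))
  rw [h0, hN] at this
  rw [← this, ← Fin.sum_univ_eq_sum_range (fun i => ∫ x in (c i)..(c (i + 1)), f x)]
  exact Finset.sum_congr rfl fun j _ => by rw [hl, hr]

/-- The representative of `x` in `[a, b)` modulo `b - a`. -/
noncomputable def wrap (_ : Mesh a b) (x : ℝ) : ℝ := a + (b - a) * Int.fract ((x - a) / (b - a))

/-- The `(b - a)`-periodic function that agrees with `P j` on the `j`-th cell. -/
noncomputable def piecewise (P : Fin m.N → Polynomial ℝ) (x : ℝ) : ℝ :=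
  ∑ j, (m.cell j).indicator (fun y => (P j).eval y) (m.wrap x)

theorem wrap_periodic (hab : a < b) : Function.Periodic m.wrap (b - a) := fun x => by
  have : (x + (b - a) - a) / (b - a) = (x - a) / (b - a) + 1 := by
    have := (sub_pos.2 hab).ne'
    field_simp
    ring
  rw [wrap, this, Int.fract_add_one, wrap]

theorem wrap_mem (hab : a < b) (x : ℝ) : m.wrap x ∈ Ico a b := by
  have h1 := Int.fract_nonneg ((x - a) / (b - a))
  have h2 := Int.fract_lt_one ((x - a) / (b - a))
  have h3 := sub_pos.2 hab
  constructor
  · rw [wrap]; nlinarith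
  · rw [wrap]; nlinarith

theorem wrap_eq_sub (hab : a < b) (x : ℝ) :
    m.wrap x = x - (⌊(x - a) / (b - a)⌋ : ℤ) * (b - a) := by
  have := (sub_pos.2 hab).ne'
  rw [wrap, Int.fract]
  field_simp
  ring

theorem wrap_of_mem (hab : a < b) {x : ℝ} (hx : x ∈ Ico a b) : m.wrap x = x := by
  have h3 := sub_pos.2 hab
  have : Int.fract ((x - a) / (b - a)) = (x - a) / (b - a) := by
    rw [Int.fract_eq_self]
    exact ⟨div_nonneg (by linarith [hx.1]) h3.le, by rw [div_lt_one h3]; linarith [hx.2]⟩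
  rw [wrap, this]
  field_simp
  ring

theorem measurable_wrap : Measurable m.wrap := by
  unfold wrap
  exact (((measurable_id.sub_const a).div_const (b - a)).fract.const_mul (b - a)).const_add a

/-- The exceptional points are translates of finitely many nodes by multiples of the period, hence
countably many. -/
theorem ae_wrap_notMem_range_node (hab : a < b) : ∀ᵐ x, m.wrap x ∉ range m.node := by
  have : {x | m.wrap x ∈ range m.node} ⊆
      ⋃ n : ℤ, (fun y => y + n * (b - a)) '' range m.node := by
    intro x hx
    refine mem_iUnion.2 ⟨⌊(x - a) / (b - a)⌋, m.wrap x, hx, ?_⟩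
    simp only [m.wrap_eq_sub hab]
    ring
  have hc : {x | m.wrap x ∈ range m.node}.Countable :=
    (countable_iUnion fun n => (Set.finite_range m.node).countable.image _).mono this
  simpa [ae_iff] using hc.measure_zero volume

theorem cell_subset (j : Fin m.N) : m.cell j ⊆ Ico a b := fun _ hx =>
  ⟨(m.le_left j).trans hx.1.le, hx.2.trans_le (m.right_le j)⟩

theorem piecewise_of_wrap_mem (P : Fin m.N → Polynomial ℝ) {x : ℝ} {j : Fin m.N}
    (hx : m.wrap x ∈ m.cell j) : m.piecewise P x = (P j).eval (m.wrap x) := by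
  rw [piecewise, Finset.sum_eq_single j, indicator_of_mem hx]
  · intro i _ hij
    exact indicator_of_notMem (fun hi => hij (m.eq_of_mem_cell hi hx)) _
  · simp

theorem piecewise_of_mem (hab : a < b) (P : Fin m.N → Polynomial ℝ) {x : ℝ} {j : Fin m.N}
    (hx : x ∈ m.cell j) : m.piecewise P x = (P j).eval x := by
  have e := m.wrap_of_mem hab (m.cell_subset j hx)
  rw [m.piecewise_of_wrap_mem (j := j) P (by rwa [e]), e]

theorem piecewise_periodic (hab : a < b) (P : Fin m.N → Polynomial ℝ) :
    Function.Periodic (m.piecewise P) (b - a) := fun x => by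
  rw [piecewise, m.wrap_periodic hab x, piecewise]

theorem measurable_piecewise (P : Fin m.N → Polynomial ℝ) : Measurable (m.piecewise P) := by
  unfold piecewise
  refine Finset.measurable_sum _ fun j _ => ?_
  exact ((P j).continuous.measurable.indicator measurableSet_Ioo).comp m.measurable_wrap

theorem memLp_top_piecewise (P : Fin m.N → Polynomial ℝ) :
    MemLp (m.piecewise P) ⊤ volume := by
  have : ∀ j, ∃ C, 0 ≤ C ∧ ∀ x ∈ m.cell j, ‖(P j).eval x‖ ≤ C := fun j => by
    obtain ⟨C, hC⟩ := isCompact_Icc.exists_bound_of_continuousOn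
      (s := Icc (m.left j) (m.right j)) (P j).continuous.continuousOn
    exact ⟨C, (norm_nonneg _).trans (hC _ (left_mem_Icc.2 (m.left_lt_right j).le)),
      fun x hx => hC x (Ioo_subset_Icc_self hx)⟩
  choose C hC0 hC using this
  refine memLp_top_of_bound (m.measurable_piecewise P).aestronglyMeasurable (∑ j, C j)
    (.of_forall fun x => ?_)
  refine (norm_sum_le _ _).trans (Finset.sum_le_sum fun j _ => ?_)
  by_cases h : m.wrap x ∈ m.cell j
  · rw [indicator_of_mem h]; exact hC j _ h
  · rw [indicator_of_notMem h, norm_zero]; exact hC0 j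

theorem piecewise_mem_dgSpace (hab : a < b) {k : ℕ} {P : Fin m.N → Polynomial ℝ}
    (hP : ∀ j, (P j).natDegree ≤ k) : m.piecewise P ∈ m.dgSpace k :=
  ⟨m.piecewise_periodic hab P, fun j => ⟨P j, hP j, fun _ hx => m.piecewise_of_mem hab P hx⟩⟩

/-- Elements of `V_h^k` are unconstrained at the nodes apart from periodicity. Passing to this
bounded Borel representative settles all questions of measurability and integrability. -/
theorem exists_ae_eq_piecewise (hab : a < b) {k : ℕ} {v : ℝ → ℝ} (hv : v ∈ m.dgSpace k) :
    ∃ P : Fin m.N → Polynomial ℝ, (∀ j, (P j).natDegree ≤ k) ∧ v =ᵐ[volume] m.piecewise P := by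
  choose P hP hPv using hv.2
  refine ⟨P, hP, ?_⟩
  filter_upwards [m.ae_wrap_notMem_range_node hab] with x hx
  obtain ⟨j, hj⟩ := m.exists_mem_cell (m.wrap_mem hab x) hx
  rw [m.piecewise_of_wrap_mem P hj, ← hPv j _ hj, m.wrap_eq_sub hab]
  exact (hv.1.sub_int_mul_eq _).symm

theorem memLp_top_of_mem_dgSpace (hab : a < b) {k : ℕ} {v : ℝ → ℝ} (hv : v ∈ m.dgSpace k) :
    MemLp v ⊤ volume := by
  obtain ⟨P, -, h⟩ := m.exists_ae_eq_piecewise hab hv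
  exact (memLp_congr_ae h).2 (m.memLp_top_piecewise P)

theorem sum_smul_mem_dgSpace {k : ℕ} {ι : Type*} (s : Finset ι) (c : ι → ℝ) {φ : ι → ℝ → ℝ}
    (hφ : ∀ i, φ i ∈ m.dgSpace k) : (fun x => ∑ i ∈ s, c i * φ i x) ∈ m.dgSpace k := by
  refine ⟨fun x => Finset.sum_congr rfl fun i _ => by rw [(hφ i).1 x], fun j => ?_⟩
  choose p hp hpe using fun i => (hφ i).2 j
  refine ⟨∑ i ∈ s, Polynomial.C (c i) * p i, ?_, fun x hx => ?_⟩
  · exact Polynomial.natDegree_sum_le_of_forall_le _ _ fun i _ =>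
      (Polynomial.natDegree_C_mul_le _ _).trans (hp i)
  · rw [Polynomial.eval_finsetSum]
    exact Finset.sum_congr rfl fun i _ => by rw [hpe i x hx]; simp

/-! ### Existence of orthonormal bases of `V_h^k` -/

/-- `φ` is an `L²(a, b)`-orthonormal basis of `V_h^k`. -/
structure IsOrthonormalBasis (k : ℕ) {n : ℕ} (φ : Fin n → ℝ → ℝ) : Prop where
  mem : ∀ i, φ i ∈ m.dgSpace k
  measurable : ∀ i, Measurable (φ i)
  orthonormal : ∀ i j, ∫ x in a..b, φ i x * φ j x = if i = j then 1 else 0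
  expand : ∀ v ∈ m.dgSpace k, v =ᵐ[volume] fun x => ∑ i, (∫ y in a..b, v y * φ i y) * φ i x

/-- `piecewise` as a linear map. -/
noncomputable def piecewiseLin (k : ℕ) :
    (Fin m.N → Polynomial.degreeLT ℝ (k + 1)) →ₗ[ℝ] ℝ → ℝ where
  toFun P := m.piecewise fun j => (P j : Polynomial ℝ)
  map_add' P Q := by
    ext x
    simp only [piecewise, Pi.add_apply, ← Finset.sum_add_distrib, Submodule.coe_add,
      Polynomial.eval_add]
    refine Finset.sum_congr rfl fun j _ => ?_
    by_cases h : m.wrap x ∈ m.cell j <;> simp [h]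
  map_smul' c P := by
    ext x
    simp only [piecewise, Pi.smul_apply, Submodule.coe_smul, Polynomial.eval_smul, smul_eq_mul,
      RingHom.id_apply, Finset.mul_sum]
    refine Finset.sum_congr rfl fun j _ => ?_
    by_cases h : m.wrap x ∈ m.cell j <;> simp [h]

theorem memLp_top_piecewiseLin (k : ℕ) (P : Fin m.N → Polynomial.degreeLT ℝ (k + 1)) :
    MemLp (m.piecewiseLin k P) ⊤ volume := m.memLp_top_piecewise _

/-- The `L²(a, b)` inner product on the coefficient space of `V_h^k`. -/
noncomputable def l2Form (k : ℕ) : LinearMap.BilinForm ℝ (Fin m.N → Polynomial.degreeLT ℝ (k + 1)) :=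
  LinearMap.mk₂ ℝ (fun P Q => ∫ x in a..b, m.piecewiseLin k P x * m.piecewiseLin k Q x)
    (fun P P' Q => by
      rw [← intervalIntegral.integral_add (intervalIntegrable_of_memLp_top
          (memLp_top_mul (m.memLp_top_piecewiseLin k P) (m.memLp_top_piecewiseLin k Q)) a b)
        (intervalIntegrable_of_memLp_top
          (memLp_top_mul (m.memLp_top_piecewiseLin k P') (m.memLp_top_piecewiseLin k Q)) a b)]
      congr 1; ext x; simp only [map_add, Pi.add_apply]; ring)
    (fun c P Q => by
      rw [smul_eq_mul, ← intervalIntegral.integral_const_mul]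
      congr 1; ext x; simp only [map_smul, Pi.smul_apply, smul_eq_mul]; ring)
    (fun P Q Q' => by
      rw [← intervalIntegral.integral_add (intervalIntegrable_of_memLp_top
          (memLp_top_mul (m.memLp_top_piecewiseLin k P) (m.memLp_top_piecewiseLin k Q)) a b)
        (intervalIntegrable_of_memLp_top
          (memLp_top_mul (m.memLp_top_piecewiseLin k P) (m.memLp_top_piecewiseLin k Q')) a b)]
      congr 1; ext x; simp only [map_add, Pi.add_apply]; ring)
    (fun c P Q => by
      rw [smul_eq_mul, ← intervalIntegral.integral_const_mul]
      congr 1; ext x; simp only [map_smul, Pi.smul_apply, smul_eq_mul]; ring)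

theorem l2Form_apply (k : ℕ) (P Q : Fin m.N → Polynomial.degreeLT ℝ (k + 1)) :
    m.l2Form k P Q = ∫ x in a..b, m.piecewiseLin k P x * m.piecewiseLin k Q x := rfl

/-- On a cell where the polynomial is nonzero, its square cannot vanish throughout, since it has
finitely many roots. -/
theorem l2Form_self_pos (hab : a < b) (k : ℕ) {P : Fin m.N → Polynomial.degreeLT ℝ (k + 1)}
    (hP : P ≠ 0) : 0 < m.l2Form k P P := by
  have hc : ∀ j, ∫ x in (m.left j)..(m.right j), m.piecewiseLin k P x * m.piecewiseLin k P x
      = ∫ x in (m.left j)..(m.right j), (P j : Polynomial ℝ).eval x ^ 2 := fun j =>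
    integral_congr_of_eqOn_Ioo (m.left_lt_right j).le fun x hx => by
      simp only [piecewiseLin, LinearMap.coe_mk, AddHom.coe_mk]
      rw [m.piecewise_of_mem hab _ hx, pow_two]
  rw [l2Form_apply, ← m.sum_integral_cell (intervalIntegrable_of_memLp_top
    (memLp_top_mul (m.memLp_top_piecewiseLin k P) (m.memLp_top_piecewiseLin k P)) a b)]
  simp only [hc]
  obtain ⟨j, hj⟩ := Function.ne_iff.1 hP
  refine Finset.sum_pos' (fun i _ => intervalIntegral.integral_nonneg (m.left_lt_right i).le
    fun x _ => sq_nonneg _) ⟨j, Finset.mem_univ _, ?_⟩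
  refine intervalIntegral.integral_pos (m.left_lt_right j)
    ((P j : Polynomial ℝ).continuous.pow 2).continuousOn (fun x _ => sq_nonneg _) ?_
  by_contra! h
  have hj' : (P j : Polynomial ℝ) ≠ 0 := fun h0 => hj (Subtype.ext h0)
  refine hj' (Polynomial.eq_zero_of_infinite_isRoot _
    ((Icc_infinite (m.left_lt_right j)).mono fun x hx => ?_))
  exact pow_eq_zero_iff (two_ne_zero) |>.1 (le_antisymm (h x hx) (sq_nonneg _))

/-- A symmetric form has an orthogonal basis, and positivity allows it to be normalised. The form
lives on tuples of polynomials, where it is definite; on functions it would ignore the values at the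
nodes. -/
theorem exists_isOrthonormalBasis (hab : a < b) (k : ℕ) :
    ∃ (n : ℕ) (φ : Fin n → ℝ → ℝ), m.IsOrthonormalBasis k φ := by
  have : Module.Finite ℝ (Polynomial.degreeLT ℝ (k + 1)) :=
    Module.Finite.equiv (Polynomial.degreeLTEquiv ℝ (k + 1)).symm
  have hsymm : LinearMap.IsSymm (m.l2Form k) := ⟨fun P Q => by
    simp only [l2Form_apply, RingHom.id_apply, mul_comm]⟩
  have : Invertible (2 : ℝ) := invertibleOfNonzero two_ne_zero
  obtain ⟨e, he⟩ := LinearMap.BilinForm.exists_orthogonal_basis hsymm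
  have hpos : ∀ i, 0 < m.l2Form k (e i) (e i) := fun i => m.l2Form_self_pos hab k (e.ne_zero i)
  set ρ : _ → ℝ := fun i => Real.sqrt (m.l2Form k (e i) (e i)) with hρ
  have hρ0 : ∀ i, ρ i ≠ 0 := fun i => (Real.sqrt_pos.2 (hpos i)).ne'
  set φ : _ → ℝ → ℝ := fun i x => (ρ i)⁻¹ * m.piecewiseLin k (e i) x with hφ
  have hon : ∀ i j, ∫ x in a..b, φ i x * φ j x = if i = j then 1 else 0 := by
    intro i j
    have : ∫ x in a..b, φ i x * φ j x = (ρ i)⁻¹ * (ρ j)⁻¹ * m.l2Form k (e i) (e j) := by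
      rw [l2Form_apply, ← intervalIntegral.integral_const_mul]
      congr 1; ext x; simp only [hφ]; ring
    rw [this]
    split_ifs with h
    · subst h
      have h2 : ρ i * ρ i = m.l2Form k (e i) (e i) := Real.mul_self_sqrt (hpos i).le
      rw [← h2]
      have := hρ0 i
      field_simp
    · rw [LinearMap.isOrthoᵢ_def.1 he i j h, mul_zero]
  have hmem : ∀ i, φ i ∈ m.dgSpace k := fun i => by
    have h := m.sum_smul_mem_dgSpace (k := k) {i} (fun i => (ρ i)⁻¹)
      (φ := fun i => m.piecewiseLin k (e i)) fun i => m.piecewise_mem_dgSpace hab fun j =>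
        mem_degreeLT_succ_iff.1 (e i j).2
    simpa using h
  have htop : ∀ i, MemLp (φ i) ⊤ volume := fun i => m.memLp_top_of_mem_dgSpace hab (hmem i)
  refine ⟨_, φ, hmem, fun i => (m.measurable_piecewise _).const_mul _, hon, fun v hv => ?_⟩
  obtain ⟨P, hP, hPv⟩ := m.exists_ae_eq_piecewise hab hv
  set Q : Fin m.N → Polynomial.degreeLT ℝ (k + 1) :=
    fun j => ⟨P j, mem_degreeLT_succ_iff.2 (hP j)⟩ with hQ
  have hexp : ∀ x, m.piecewise P x = ∑ i, (e.repr Q i * ρ i) * φ i x := by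
    intro x
    have h1 : m.piecewise P = m.piecewiseLin k Q := rfl
    rw [h1]
    conv_lhs => rw [← e.sum_repr Q, map_sum, Finset.sum_apply]
    refine Finset.sum_congr rfl fun i _ => ?_
    simp only [map_smul, Pi.smul_apply, smul_eq_mul, hφ]
    have := hρ0 i
    field_simp
  have hcoef : ∀ i, ∫ y in a..b, v y * φ i y = e.repr Q i * ρ i := by
    intro i
    have h1 : ∫ y in a..b, v y * φ i y
        = ∫ y in a..b, ∑ l, (e.repr Q l * ρ l) * (φ l y * φ i y) := by
      refine intervalIntegral.integral_congr_ae ?_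
      filter_upwards [hPv] with y hy _
      rw [hy, hexp, Finset.sum_mul]
      exact Finset.sum_congr rfl fun l _ => by ring
    rw [h1, intervalIntegral.integral_finsetSum fun l _ =>
      (intervalIntegrable_of_memLp_top (memLp_top_mul (htop l) (htop i)) a b).const_mul _]
    simp [intervalIntegral.integral_const_mul, hon]
  filter_upwards [hPv] with x hx
  rw [hx, hexp]
  exact Finset.sum_congr rfl fun i _ => by rw [hcoef]

end Mesh

end NonlocalDG

namespace NonlocalDG

open MeasureTheory Set Filter Topology

/-! ### Pythagoras, Bessel and best approximation in `V_h^k` -/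

namespace Mesh.IsOrthonormalBasis

variable {a b : ℝ} {m : Mesh a b} {k n : ℕ} {φ : Fin n → ℝ → ℝ}

theorem memLp_top (hφ : m.IsOrthonormalBasis k φ) (hab : a < b) (i : Fin n) :
    MemLp (φ i) ⊤ volume := m.memLp_top_of_mem_dgSpace hab (hφ.mem i)

theorem sum_memLp_top (hφ : m.IsOrthonormalBasis k φ) (hab : a < b) (c : Fin n → ℝ) :
    MemLp (fun x => ∑ i, c i * φ i x) ⊤ volume :=
  m.memLp_top_of_mem_dgSpace hab (m.sum_smul_mem_dgSpace _ c hφ.mem)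

theorem integral_mul_sum (hφ : m.IsOrthonormalBasis k φ) (hab : a < b) (c : Fin n → ℝ)
    {f : ℝ → ℝ} (hf : MemLp f ⊤ volume) :
    ∫ x in a..b, f x * ∑ i, c i * φ i x = ∑ i, c i * ∫ x in a..b, f x * φ i x := by
  simp_rw [Finset.mul_sum, ← intervalIntegral.integral_const_mul]
  rw [intervalIntegral.integral_finsetSum fun i _ => intervalIntegrable_of_memLp_top
    (memLp_top_mul hf ((hφ.memLp_top hab i).const_mul _)) a b]
  refine Finset.sum_congr rfl fun i _ => ?_
  congr 1; ext x; ring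

theorem integral_sum_mul (hφ : m.IsOrthonormalBasis k φ) (hab : a < b) (c : Fin n → ℝ)
    (i : Fin n) : ∫ x in a..b, (∑ l, c l * φ l x) * φ i x = c i := by
  have := hφ.integral_mul_sum hab c (hφ.memLp_top hab i)
  simp only [hφ.orthonormal, mul_ite, mul_one, mul_zero, Finset.sum_ite_eq, Finset.mem_univ,
    if_true] at this
  rw [← this]
  congr 1; ext x; ring

/-- Pythagoras: the first sum is the distance within the space, and the last bracket is the squared
distance of `f` from the space, independent of `c`. -/
theorem integral_sum_sub_sq (hφ : m.IsOrthonormalBasis k φ) (hab : a < b) (c : Fin n → ℝ)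
    {f : ℝ → ℝ} (hf : MemLp f ⊤ volume) :
    ∫ x in a..b, ((∑ i, c i * φ i x) - f x) ^ 2
      = ∑ i, (c i - ∫ x in a..b, f x * φ i x) ^ 2
        + ((∫ x in a..b, f x ^ 2) - ∑ i, (∫ x in a..b, f x * φ i x) ^ 2) := by
  have hs := hφ.sum_memLp_top hab c
  have h1 : ∫ x in a..b, ((∑ i, c i * φ i x) - f x) ^ 2
      = (∫ x in a..b, (∑ i, c i * φ i x) * ∑ i, c i * φ i x)
        - 2 * (∫ x in a..b, f x * ∑ i, c i * φ i x) + ∫ x in a..b, f x ^ 2 := by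
    rw [← intervalIntegral.integral_const_mul, ← intervalIntegral.integral_sub,
      ← intervalIntegral.integral_add]
    · congr 1; ext x; ring
    · exact intervalIntegrable_of_memLp_top
        ((memLp_top_mul hs hs).sub ((memLp_top_mul hf hs).const_mul 2)) a b
    · exact intervalIntegrable_of_memLp_top (memLp_top_sq hf) a b
    · exact intervalIntegrable_of_memLp_top (memLp_top_mul hs hs) a b
    · exact intervalIntegrable_of_memLp_top ((memLp_top_mul hf hs).const_mul 2) a b
  rw [h1, hφ.integral_mul_sum hab c hs, hφ.integral_mul_sum hab c hf]
  simp only [hφ.integral_sum_mul hab]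
  have : ∀ i, (c i - ∫ x in a..b, f x * φ i x) ^ 2
      = c i * c i - 2 * (c i * ∫ x in a..b, f x * φ i x) + (∫ x in a..b, f x * φ i x) ^ 2 :=
    fun i => by ring
  simp only [this, Finset.sum_add_distrib, Finset.sum_sub_distrib, ← Finset.mul_sum]
  ring

theorem integral_sum_sq (hφ : m.IsOrthonormalBasis k φ) (hab : a < b) (c : Fin n → ℝ) :
    ∫ x in a..b, (∑ i, c i * φ i x) ^ 2 = ∑ i, c i ^ 2 := by
  simpa using hφ.integral_sum_sub_sq hab c (f := fun _ => 0) MemLp.zero'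

theorem sum_sq_le (hφ : m.IsOrthonormalBasis k φ) (hab : a < b) {f : ℝ → ℝ}
    (hf : MemLp f ⊤ volume) :
    ∑ i, (∫ x in a..b, f x * φ i x) ^ 2 ≤ ∫ x in a..b, f x ^ 2 := by
  have h := hφ.integral_sum_sub_sq hab (fun i => ∫ x in a..b, f x * φ i x) hf
  have h0 : 0 ≤ ∫ x in a..b, ((∑ i, (∫ y in a..b, f y * φ i y) * φ i x) - f x) ^ 2 :=
    intervalIntegral.integral_nonneg hab.le fun x _ => sq_nonneg _
  simp only [sub_self, ne_eq, OfNat.ofNat_ne_zero, not_false_eq_true, zero_pow,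
    Finset.sum_const_zero, zero_add] at h
  linarith

/-- Approximation property of `V_h^k`: the distance from `v ∈ V_h^k` to a smooth `f` is controlled
by the projection of `v - f` to `V_h^k`. -/
theorem integral_sub_sq_le (hφ : m.IsOrthonormalBasis k φ) (hab : a < b) {v f : ℝ → ℝ}
    (hv : v ∈ m.dgSpace k) (hf : ContDiff ℝ ((k + 1 : ℕ) : WithTop ℕ∞) f)
    (hp : Function.Periodic f (b - a)) :
    ∫ x in a..b, (v x - f x) ^ 2 ≤ ∑ i, (∫ x in a..b, (v x - f x) * φ i x) ^ 2
      + m.size ^ (2 * k + 2) * ∫ x in a..b, (iteratedDeriv (k + 1) f x) ^ 2 := by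
  have hftop : MemLp f ⊤ volume :=
    memLp_top_of_continuous_periodic (sub_pos.2 hab) hf.continuous hp
  have hident : ∀ w ∈ m.dgSpace k, ∫ x in a..b, (w x - f x) ^ 2
      = ∑ i, (∫ x in a..b, (w x - f x) * φ i x) ^ 2
        + ((∫ x in a..b, f x ^ 2) - ∑ i, (∫ x in a..b, f x * φ i x) ^ 2) := by
    intro w hw
    have hwtop := m.memLp_top_of_mem_dgSpace hab hw
    have e : ∫ x in a..b, (w x - f x) ^ 2
        = ∫ x in a..b, ((∑ i, (∫ y in a..b, w y * φ i y) * φ i x) - f x) ^ 2 := by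
      refine intervalIntegral.integral_congr_ae ?_
      filter_upwards [hφ.expand w hw] with x hx _
      rw [← hx]
    rw [e, hφ.integral_sum_sub_sq hab _ hftop]
    congr 1
    refine Finset.sum_congr rfl fun i _ => ?_
    rw [← intervalIntegral.integral_sub
      (intervalIntegrable_of_memLp_top (memLp_top_mul hwtop (hφ.memLp_top hab i)) a b)
      (intervalIntegrable_of_memLp_top (memLp_top_mul hftop (hφ.memLp_top hab i)) a b)]
    congr 2; ext x; ring
  -- The bracket in `hident` is the same for all `w`. A competitor made of cellwise polynomial
  -- approximants bounds it, since the coordinate sum of that competitor is nonnegative.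
  choose P hP hPle using fun j =>
    exists_polynomial_integral_sq_le (m.left_lt_right j).le (k + 1) f hf
  have hPmem := m.piecewise_mem_dgSpace hab fun j => mem_degreeLT_succ_iff.1 (hP j)
  have hD : Continuous (iteratedDeriv (k + 1) f) := hf.continuous_iteratedDeriv _ le_rfl
  have happrox : ∫ x in a..b, (m.piecewise P x - f x) ^ 2
      ≤ m.size ^ (2 * k + 2) * ∫ x in a..b, (iteratedDeriv (k + 1) f x) ^ 2 := by
    have hsq : IntervalIntegrable (fun x => (m.piecewise P x - f x) ^ 2) volume a b :=
      intervalIntegrable_of_memLp_top (memLp_top_sq ((m.memLp_top_piecewise P).sub hftop)) a b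
    have hDsq : IntervalIntegrable (fun x => iteratedDeriv (k + 1) f x ^ 2) volume a b :=
      (hD.pow 2).intervalIntegrable a b
    rw [← m.sum_integral_cell hsq, ← m.sum_integral_cell hDsq, Finset.mul_sum]
    refine Finset.sum_le_sum fun j _ => ?_
    have e : ∫ x in (m.left j)..(m.right j), (m.piecewise P x - f x) ^ 2
        = ∫ x in (m.left j)..(m.right j), (f x - (P j).eval x) ^ 2 :=
      integral_congr_of_eqOn_Ioo (m.left_lt_right j).le fun x hx => by
        rw [m.piecewise_of_mem hab P hx]; ring
    refine e.trans_le ((hPle j).trans (mul_le_mul_of_nonneg_right ?_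
      (intervalIntegral.integral_nonneg (m.left_lt_right j).le fun x _ => sq_nonneg _)))
    exact pow_le_pow_left₀ (sub_nonneg.2 (m.left_lt_right j).le) (m.length_le_size j) _
  have h1 := hident v hv
  have h2 := hident _ hPmem
  have h3 : 0 ≤ ∑ i, (∫ x in a..b, (m.piecewise P x - f x) * φ i x) ^ 2 :=
    Finset.sum_nonneg fun i _ => sq_nonneg _
  linarith

end Mesh.IsOrthonormalBasis

/-! ### Time derivatives of functions with values in `V_h^k` -/

section TimeDerivative

variable {a b T : ℝ} (m : Mesh a b) {k : ℕ}

/-- Lagrange interpolation at `k + 1` points fixed in the cell. It reduces a time-dependent element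
of `V_h^k` to finitely many functions of time, so that smoothness in `t` at each single `x` suffices
to differentiate under the integral and to stay in `V_h^k`. -/
theorem Mesh.exists_interpolation (k : ℕ) (j : Fin m.N) :
    ∃ (y : Fin (k + 1) → ℝ) (l : Fin (k + 1) → Polynomial ℝ), (∀ i, y i ∈ m.cell j) ∧
      (∀ i, (l i).natDegree ≤ k) ∧
      ∀ v ∈ m.dgSpace k, ∀ x ∈ m.cell j, v x = ∑ i, v (y i) * (l i).eval x := by
  obtain ⟨s, hs, hcard⟩ := (Ioo_infinite (m.left_lt_right j)).exists_subset_card_eq (k + 1)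
  let e : Fin (k + 1) ≃ s := (s.equivFinOfCardEq hcard).symm
  have hinj : Function.Injective fun i => (e i : ℝ) := Subtype.val_injective.comp e.injective
  have hy : ∀ i, (e i : ℝ) ∈ m.cell j := fun i => hs (e i).2
  refine ⟨fun i => e i, Lagrange.basis Finset.univ fun i => (e i : ℝ), hy, fun i => ?_, ?_⟩
  · refine Polynomial.natDegree_le_of_degree_le ?_
    rw [Lagrange.degree_basis hinj.injOn (Finset.mem_univ i)]
    simp
  · intro v hv x hx
    obtain ⟨p, hp, hpe⟩ := hv.2 j
    have hpd : p.degree < (Finset.univ : Finset (Fin (k + 1))).card := by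
      have := Polynomial.mem_degreeLT.1 (mem_degreeLT_succ_iff.2 hp)
      simpa using this
    have := Lagrange.eq_interpolate hinj.injOn hpd
    rw [hpe x hx]
    conv_lhs => rw [this]
    rw [Lagrange.interpolate_apply, Polynomial.eval_finsetSum]
    refine Finset.sum_congr rfl fun i _ => ?_
    rw [Polynomial.eval_mul, Polynomial.eval_C, hpe _ (hy i)]

variable {w : ℝ → ℝ → ℝ}

theorem hasDerivWithinAt_dt {x t : ℝ} (h : DifferentiableOn ℝ (fun τ => w x τ) (Icc 0 T))
    (ht : t ∈ Icc 0 T) : HasDerivWithinAt (fun τ => w x τ) (dt T w x t) (Icc 0 T) t :=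
  (h t ht).hasDerivWithinAt

theorem dt_periodic {c : ℝ} (hw : ∀ t ∈ Icc 0 T, Function.Periodic (fun x => w x t) c) {t : ℝ}
    (ht : t ∈ Icc 0 T) : Function.Periodic (fun x => dt T w x t) c := fun x =>
  derivWithin_congr (fun τ hτ => hw τ hτ x) (hw t ht x)

theorem Mesh.dt_mem_dgSpace (hT : 0 < T)
    (hw : ∀ t ∈ Icc 0 T, (fun x => w x t) ∈ m.dgSpace k)
    (hd : ∀ j, ∀ x ∈ m.cell j, DifferentiableOn ℝ (fun t => w x t) (Icc 0 T)) {t : ℝ}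
    (ht : t ∈ Icc 0 T) : (fun x => dt T w x t) ∈ m.dgSpace k := by
  refine ⟨dt_periodic (fun τ hτ => (hw τ hτ).1) ht, fun j => ?_⟩
  obtain ⟨y, l, hy, hl, hrep⟩ := m.exists_interpolation k j
  refine ⟨∑ i, Polynomial.C (dt T w (y i) t) * l i,
    Polynomial.natDegree_sum_le_of_forall_le _ _ fun i _ =>
      (Polynomial.natDegree_C_mul_le _ _).trans (hl i), fun x hx => ?_⟩
  have h1 : HasDerivWithinAt (fun τ => ∑ i, w (y i) τ * (l i).eval x)
      (∑ i, dt T w (y i) t * (l i).eval x) (Icc 0 T) t :=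
    HasDerivWithinAt.fun_sum fun i _ =>
      (hasDerivWithinAt_dt (hd j _ (hy i)) ht).mul_const _
  have h2 := h1.congr_of_mem (f₁ := fun τ => w x τ) (fun τ hτ => hrep _ (hw τ hτ) x hx) ht
  change derivWithin (fun τ => w x τ) (Icc 0 T) t = _
  rw [h2.derivWithin (uniqueDiffOn_Icc hT t ht), Polynomial.eval_finsetSum]
  simp

theorem Mesh.hasDerivWithinAt_integral_mul (hab : a < b) (hT : 0 < T)
    (hw : ∀ t ∈ Icc 0 T, (fun x => w x t) ∈ m.dgSpace k)
    (hd : ∀ j, ∀ x ∈ m.cell j, DifferentiableOn ℝ (fun t => w x t) (Icc 0 T))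
    {g : ℝ → ℝ} (hg : MemLp g ⊤ volume) {t : ℝ} (ht : t ∈ Icc 0 T) :
    HasDerivWithinAt (fun τ => ∫ x in a..b, w x τ * g x) (∫ x in a..b, dt T w x t * g x)
      (Icc 0 T) t := by
  choose y l hy hl hrep using m.exists_interpolation k
  have hint : ∀ v ∈ m.dgSpace k, ∫ x in a..b, v x * g x
      = ∑ j, ∑ i, v (y j i) * ∫ x in (m.left j)..(m.right j), (l j i).eval x * g x := by
    intro v hv
    rw [← m.sum_integral_cell (intervalIntegrable_of_memLp_top
      (memLp_top_mul (m.memLp_top_of_mem_dgSpace hab hv) hg) a b)]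
    refine Finset.sum_congr rfl fun j _ => ?_
    have hgj := intervalIntegrable_of_memLp_top hg (m.left j) (m.right j)
    rw [integral_congr_of_eqOn_Ioo (m.left_lt_right j).le
      (g := fun x => ∑ i, v (y j i) * ((l j i).eval x * g x)) fun x hx => by
        simp only [hrep j v hv x hx, Finset.sum_mul, mul_assoc]]
    rw [intervalIntegral.integral_finsetSum fun i _ =>
      (hgj.continuousOn_mul (l j i).continuous.continuousOn).const_mul _]
    simp only [intervalIntegral.integral_const_mul]
  rw [hint _ (m.dt_mem_dgSpace hT hw hd ht)]
  refine HasDerivWithinAt.congr_of_mem (f := fun τ => ∑ j, ∑ i, w (y j i) τ *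
    ∫ x in (m.left j)..(m.right j), (l j i).eval x * g x) ?_ (fun τ hτ => hint _ (hw τ hτ)) ht
  exact HasDerivWithinAt.fun_sum fun j _ => HasDerivWithinAt.fun_sum fun i _ =>
    (hasDerivWithinAt_dt (hd j _ (hy j i)) ht).mul_const _

end TimeDerivative

/-! ### Regularity in time of the exact solution and of its moments -/

section SmoothFamilies

variable {a b T : ℝ} {U : ℝ → ℝ → ℝ}

theorem contDiff_slice {n : WithTop ℕ∞}
    (hU : ContDiffOn ℝ n (fun p : ℝ × ℝ => U p.1 p.2) (univ ×ˢ Icc 0 T)) {t : ℝ}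
    (ht : t ∈ Icc 0 T) : ContDiff ℝ n fun x => U x t := by
  rw [← contDiffOn_univ]
  exact hU.comp (f := fun x : ℝ => (x, t)) (by fun_prop) fun x _ => ⟨mem_univ _, ht⟩

theorem differentiableOn_time
    (hU : ContDiffOn ℝ 1 (fun p : ℝ × ℝ => U p.1 p.2) (univ ×ˢ Icc 0 T)) (x : ℝ) :
    DifferentiableOn ℝ (fun t => U x t) (Icc 0 T) :=
  (hU.differentiableOn one_ne_zero).comp (f := fun t : ℝ => (x, t)) (by fun_prop)
    fun t ht => ⟨mem_univ _, ht⟩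

/-- The one-sided time derivative is the derivative within the closed strip applied to the vector
`(0, 1)`, hence loses one order of joint regularity. -/
theorem contDiffOn_dt (hT : 0 < T) {n : ℕ}
    (hU : ContDiffOn ℝ ((n + 1 : ℕ) : WithTop ℕ∞) (fun p : ℝ × ℝ => U p.1 p.2)
      (univ ×ˢ Icc 0 T)) :
    ContDiffOn ℝ (n : WithTop ℕ∞) (fun p : ℝ × ℝ => dt T U p.1 p.2) (univ ×ˢ Icc 0 T) := by
  have hud : UniqueDiffOn ℝ ((univ : Set ℝ) ×ˢ Icc 0 T) :=
    uniqueDiffOn_univ.prod (uniqueDiffOn_Icc hT)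
  have h1 := hU.fderivWithin hud (m := (n : WithTop ℕ∞)) (by exact_mod_cast le_rfl)
  refine (h1.clm_apply (contDiffOn_const (c := ((0 : ℝ), (1 : ℝ))))).congr fun p hp => ?_
  have h2 := (hU.differentiableOn (by simp) p hp).hasFDerivWithinAt
  have h3 : HasDerivWithinAt (fun τ : ℝ => (p.1, τ)) ((0 : ℝ), (1 : ℝ)) (Icc 0 T) p.2 :=
    (hasDerivWithinAt_const _ _ _).prodMk (hasDerivWithinAt_id _ _)
  have h4 := HasFDerivWithinAt.comp_hasDerivWithinAt (f := fun τ : ℝ => (p.1, τ)) p.2 h2 h3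
    fun τ hτ => ⟨mem_univ _, hτ⟩
  exact h4.derivWithin (uniqueDiffOn_Icc hT p.2 hp.2)

theorem exists_bound_on_rectangle
    (hU : ContinuousOn (fun p : ℝ × ℝ => U p.1 p.2) (univ ×ˢ Icc 0 T)) (a b : ℝ) :
    ∃ C, ∀ x ∈ Icc a b, ∀ t ∈ Icc 0 T, ‖U x t‖ ≤ C := by
  obtain ⟨C, hC⟩ := (isCompact_Icc (a := a) (b := b)).prod (isCompact_Icc (a := (0 : ℝ)) (b := T))
    |>.exists_bound_of_continuousOn (hU.mono (prod_mono (subset_univ _) le_rfl))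
  exact ⟨C, fun x hx t ht => hC (x, t) ⟨hx, ht⟩⟩

theorem continuous_slice
    (hU : ContinuousOn (fun p : ℝ × ℝ => U p.1 p.2) (univ ×ˢ Icc 0 T)) {t : ℝ}
    (ht : t ∈ Icc 0 T) : Continuous fun x => U x t := by
  rw [← continuousOn_univ]
  exact hU.comp (f := fun x : ℝ => (x, t)) (by fun_prop) fun x _ => ⟨mem_univ _, ht⟩

theorem continuousOn_integral_mul (hab : a < b)
    (hU : ContinuousOn (fun p : ℝ × ℝ => U p.1 p.2) (univ ×ˢ Icc 0 T))
    {g : ℝ → ℝ} (hg : MemLp g ⊤ volume) :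
    ContinuousOn (fun t => ∫ x in a..b, U x t * g x) (Icc 0 T) := by
  obtain ⟨C, hC⟩ := exists_bound_on_rectangle hU a b
  intro t ht
  refine intervalIntegral.continuousWithinAt_of_dominated_interval
    (bound := fun x => C * ‖g x‖) ?_ ?_ ?_ ?_
  · filter_upwards [self_mem_nhdsWithin] with τ hτ
    exact ((continuous_slice hU hτ).aestronglyMeasurable.mul hg.1).restrict
  · filter_upwards [self_mem_nhdsWithin] with τ hτ
    refine .of_forall fun x hx => ?_
    rw [norm_mul]
    rw [uIoc_of_le hab.le] at hx
    exact mul_le_mul_of_nonneg_right (hC x (Ioc_subset_Icc_self hx) τ hτ) (norm_nonneg _)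
  · exact (intervalIntegrable_of_memLp_top hg a b).norm.const_mul C
  · refine .of_forall fun x _ => ?_
    exact ((hU.comp (f := fun τ : ℝ => (x, τ)) (by fun_prop)
      fun τ hτ => ⟨mem_univ _, hτ⟩) t ht).mul continuousWithinAt_const

theorem hasDerivAt_integral_mul (hab : a < b) (hT : 0 < T)
    (hU : ContDiffOn ℝ 1 (fun p : ℝ × ℝ => U p.1 p.2) (univ ×ˢ Icc 0 T))
    {g : ℝ → ℝ} (hg : MemLp g ⊤ volume) {t : ℝ} (ht : t ∈ Ioo 0 T) :
    HasDerivAt (fun τ => ∫ x in a..b, U x τ * g x) (∫ x in a..b, dt T U x t * g x) t := by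
  have hdt : ContinuousOn (fun p : ℝ × ℝ => dt T U p.1 p.2) (univ ×ˢ Icc 0 T) :=
    (contDiffOn_dt (n := 0) hT (by simpa using hU)).continuousOn
  obtain ⟨C, hC⟩ := exists_bound_on_rectangle hdt a b
  have hmem := Ioo_subset_Icc_self ht
  refine (intervalIntegral.hasDerivAt_integral_of_dominated_loc_of_deriv_le
    (F := fun τ x => U x τ * g x) (F' := fun τ x => dt T U x τ * g x)
    (bound := fun x => C * ‖g x‖) (s := Ioo 0 T) (isOpen_Ioo.mem_nhds ht)
    ?_ ?_ ?_ ?_ ?_ ?_).2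
  · filter_upwards [isOpen_Ioo.mem_nhds ht] with τ hτ
    exact ((continuous_slice hU.continuousOn
      (Ioo_subset_Icc_self hτ)).aestronglyMeasurable.mul hg.1).restrict
  · exact (intervalIntegrable_of_memLp_top hg a b).continuousOn_mul
      (continuous_slice hU.continuousOn hmem).continuousOn
  · exact ((continuous_slice hdt hmem).aestronglyMeasurable.mul hg.1).restrict
  · refine .of_forall fun x hx τ hτ => ?_
    rw [norm_mul]
    rw [uIoc_of_le hab.le] at hx
    exact mul_le_mul_of_nonneg_right
      (hC x (Ioc_subset_Icc_self hx) τ (Ioo_subset_Icc_self hτ)) (norm_nonneg _)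
  · exact (intervalIntegrable_of_memLp_top hg a b).norm.const_mul C
  · refine .of_forall fun x _ τ hτ => ?_
    exact ((hasDerivWithinAt_dt (differentiableOn_time hU x)
      (Ioo_subset_Icc_self hτ)).hasDerivAt (Icc_mem_nhds hτ.1 hτ.2)).mul_const _

end SmoothFamilies

end NonlocalDG

namespace NonlocalDG

open MeasureTheory Set Filter Topology

/-! ### From Sobolev bounds on `q` to Sobolev bounds on `u` -/

section Seminorm

variable {a b δ : ℝ}

theorem iteratedDeriv_periodic {v : ℝ → ℝ} {c : ℝ} (hv : Function.Periodic v c) (n : ℕ) :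
    Function.Periodic (iteratedDeriv n v) c := fun x => by
  have h : (fun z => v (z + c)) = v := funext hv
  have := congrFun (iteratedDeriv_comp_add_const n v c) x
  rw [h] at this
  exact this.symm

theorem integral_eq_of_periodic {f : ℝ → ℝ} (hf : Function.Periodic f (b - a)) (c : ℝ) :
    ∫ x in c..(c + (b - a)), f x = ∫ x in a..b, f x := by
  rw [hf.intervalIntegral_add_eq c a, add_sub_cancel]

/-- A uniform `L²` bound for the difference quotients passes to the derivative. -/
theorem integral_deriv_sq_le_of_diffQuotient (hδ : 0 < δ) {w w' : ℝ → ℝ}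
    (hw : ∀ x, HasDerivAt w (w' x) x) (hw' : Continuous w') {B : ℝ}
    (hB : ∀ s ∈ Ioc 0 δ, ∫ x in a..b, (1 / s * (w (x + s) - w x)) ^ 2 ≤ B) :
    ∫ x in a..b, w' x ^ 2 ≤ B := by
  -- The mean of `w'` over `[x, x + s]`: it is the difference quotient for `s > 0`, and it extends
  -- continuously to `s = 0` with value `w'`.
  set g : ℝ → ℝ → ℝ := fun s x => ∫ θ in (0 : ℝ)..1, w' (x + θ * s) with hg
  have hgc : Continuous fun p : ℝ × ℝ => g p.1 p.2 := by
    refine intervalIntegral.continuous_parametric_intervalIntegral_of_continuous'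
      (f := fun (p : ℝ × ℝ) θ => w' (p.2 + θ * p.1)) ?_ 0 1
    fun_prop
  have hI : Continuous fun s => ∫ x in a..b, g s x ^ 2 := by
    refine intervalIntegral.continuous_parametric_intervalIntegral_of_continuous'
      (f := fun s x => g s x ^ 2) ?_ a b
    exact hgc.pow 2
  have hle : ∀ s ∈ Ioc 0 δ, ∫ x in a..b, g s x ^ 2 ≤ B := by
    intro s hs
    refine le_of_eq_of_le ?_ (hB s hs)
    congr 1
    ext x
    have h1 := intervalIntegral.integral_eq_sub_of_hasDerivAt (a := x) (b := x + s)
      (fun y _ => hw y) (hw'.intervalIntegrable _ _)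
    have h2 := intervalIntegral.integral_comp_add_mul (a := 0) (b := 1) w' hs.1.ne' x
    simp only [hg]
    simp_rw [mul_comm _ s]
    rw [h2, mul_zero, add_zero, mul_one, h1, smul_eq_mul, one_div]
  have hlim : Tendsto (fun s => ∫ x in a..b, g s x ^ 2) (𝓝[>] 0) (𝓝 (∫ x in a..b, g 0 x ^ 2)) :=
    (hI.tendsto 0).mono_left nhdsWithin_le_nhds
  have h0 : ∫ x in a..b, g 0 x ^ 2 ≤ B :=
    le_of_tendsto hlim (by filter_upwards [Ioc_mem_nhdsGT hδ] with s hs using hle s hs)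
  simpa [hg] using h0

/-- Poincaré's inequality for derivatives of periodic functions. -/
theorem integral_iteratedDeriv_sq_le (hab : a < b) {k : ℕ} {v : ℝ → ℝ}
    (hv : ContDiff ℝ ((k + 2 : ℕ) : WithTop ℕ∞) v) (hp : Function.Periodic v (b - a)) :
    ∫ x in a..b, iteratedDeriv (k + 1) v x ^ 2
      ≤ (b - a) ^ 2 * ∫ x in a..b, iteratedDeriv (k + 2) v x ^ 2 := by
  have hd : ∀ j, j < k + 2 → ∀ x,
      HasDerivAt (iteratedDeriv j v) (iteratedDeriv (j + 1) v x) x := fun j hj x => by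
    rw [iteratedDeriv_succ]
    exact (hv.differentiable_iteratedDeriv j (by exact_mod_cast hj) x).hasDerivAt
  have hc : ∀ j, j ≤ k + 2 → Continuous (iteratedDeriv j v) := fun j hj =>
    hv.continuous_iteratedDeriv j (by exact_mod_cast hj)
  have hper := fun j => iteratedDeriv_periodic hp j
  -- Rolle's theorem for the periodic `k`-th derivative gives a zero `c` of the next one. Poincaré's
  -- inequality is then applied on the period that starts at `c`.
  obtain ⟨c, -, hc0⟩ := exists_hasDerivAt_eq_zero hab (hc k (by omega)).continuousOn
    (by have := hper k a; rw [add_sub_cancel] at this; exact this.symm)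
    fun _ _ => hd k (by omega) _
  have h := integral_sq_le_of_eq_zero_left (l := c) (r := c + (b - a)) (by linarith)
    (hd (k + 1) (by omega)) (hc (k + 2) le_rfl) hc0
  have hsq : ∀ j, Function.Periodic (fun x => iteratedDeriv j v x ^ 2) (b - a) := fun j x => by
    simp only [hper j x]
  rw [integral_eq_of_periodic (hsq (k + 1)), integral_eq_of_periodic (hsq (k + 2)),
    add_sub_cancel_left] at h
  exact h

theorem iteratedDeriv_diffQuotient {n : ℕ} {v : ℝ → ℝ} (hv : ContDiff ℝ (n : WithTop ℕ∞) v)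
    (s x : ℝ) : iteratedDeriv n (fun x => 1 / s * (v (x + s) - v x)) x
      = 1 / s * (iteratedDeriv n v (x + s) - iteratedDeriv n v x) := by
  have h1 : ContDiff ℝ (n : WithTop ℕ∞) fun x => v (x + s) := hv.comp (by fun_prop)
  have h2 : ContDiff ℝ (n : WithTop ℕ∞) fun x => v (x + s) - v x := h1.sub hv
  rw [iteratedDeriv_const_mul_field, iteratedDeriv_fun_sub h1.contDiffAt hv.contDiffAt,
    iteratedDeriv_comp_add_const]

theorem l2Norm_sq (hab : a ≤ b) (v : ℝ → ℝ) : l2Norm a b v ^ 2 = ∫ x in a..b, v x ^ 2 :=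
  Real.sq_sqrt (intervalIntegral.integral_nonneg hab fun _ _ => sq_nonneg _)

theorem integral_sq_le_of_hSeminorm_le (hab : a ≤ b) {n : ℕ} {v : ℝ → ℝ} {M : ℝ}
    (h : hSeminorm a b n v ≤ M) : ∫ x in a..b, iteratedDeriv n v x ^ 2 ≤ M ^ 2 := by
  rw [← l2Norm_sq hab]
  exact pow_le_pow_left₀ (Real.sqrt_nonneg _) h 2

/-- The data bound `q` and `u_t` but not `u` itself. The limit `s → 0` bounds the derivative of
order `k + 2` by `M`, and Poincaré's inequality costs the factor `b - a`. -/
theorem integral_iteratedDeriv_sq_le_of_diffQuotient (hab : a < b) (hδ : 0 < δ) {k : ℕ} {M : ℝ}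
    {v : ℝ → ℝ} (hv : ContDiff ℝ ((k + 2 : ℕ) : WithTop ℕ∞) v)
    (hp : Function.Periodic v (b - a))
    (hM : ∀ s ∈ Ioc 0 δ, hSeminorm a b (k + 1) (fun x => 1 / s * (v (x + s) - v x)) ≤ M) :
    ∫ x in a..b, iteratedDeriv (k + 1) v x ^ 2 ≤ (b - a) ^ 2 * M ^ 2 := by
  refine (integral_iteratedDeriv_sq_le hab hv hp).trans
    (mul_le_mul_of_nonneg_left ?_ (sq_nonneg _))
  have hv1 : ContDiff ℝ ((k + 1 : ℕ) : WithTop ℕ∞) v := hv.of_le (by exact_mod_cast by omega)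
  refine integral_deriv_sq_le_of_diffQuotient hδ (w := iteratedDeriv (k + 1) v) (fun x => ?_)
    (hv.continuous_iteratedDeriv _ le_rfl) fun s hs => ?_
  · have := (hv.differentiable_iteratedDeriv (k + 1)
      (by exact_mod_cast Nat.lt_succ_self _) x).hasDerivAt
    rwa [← iteratedDeriv_succ] at this
  · have := integral_sq_le_of_hSeminorm_le hab.le (hM s hs)
    simpa only [iteratedDeriv_diffQuotient hv1] using this

end Seminorm

end NonlocalDG

/-! ### The nonlocal operator and its kernel integrals -/

namespace NonlocalDG

open MeasureTheory Set Filter Topology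

/-- The weak form of the backward difference quotient. -/
noncomputable def diffForm (a b : ℝ) (f g : ℝ → ℝ) (s : ℝ) : ℝ :=
  ∫ x in a..b, 1 / s * (f x - f (x - s)) * g x

variable {a b δ : ℝ}

theorem diffForm_congr_ae {f f' g : ℝ → ℝ} (h : f =ᵐ[volume] f') (s : ℝ) :
    diffForm a b f g s = diffForm a b f' g s := by
  refine intervalIntegral.integral_congr_ae ?_
  filter_upwards [h, (measurePreserving_sub_right volume s).quasiMeasurePreserving.ae_eq_comp h]
    with x h1 h2 _
  simp only [Function.comp_apply] at h2
  rw [h1, h2]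

theorem intervalIntegrable_diffForm {f g : ℝ → ℝ} (hf : MemLp f ⊤ volume)
    (hg : MemLp g ⊤ volume) (s : ℝ) :
    IntervalIntegrable (fun x => 1 / s * (f x - f (x - s)) * g x) volume a b :=
  intervalIntegrable_of_memLp_top
    (memLp_top_mul ((hf.sub (memLp_top_comp_sub hf s)).const_mul (1 / s)) hg) a b

theorem diffForm_add {f f' g : ℝ → ℝ} (hf : MemLp f ⊤ volume) (hf' : MemLp f' ⊤ volume)
    (hg : MemLp g ⊤ volume) (s : ℝ) :
    diffForm a b (fun x => f x + f' x) g s = diffForm a b f g s + diffForm a b f' g s := by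
  rw [diffForm, diffForm, diffForm, ← intervalIntegral.integral_add
    (intervalIntegrable_diffForm hf hg s) (intervalIntegrable_diffForm hf' hg s)]
  congr 1; ext x; ring

/-- The scheme is tested cell by cell, whereas the shift estimates use whole periods; truncating the
test function reconciles the two. -/
theorem integral_cell_eq_integral_indicator (m : Mesh a b) (j : Fin m.N) (f g : ℝ → ℝ) :
    ∫ x in (m.left j)..(m.right j), f x * g x
      = ∫ x in a..b, f x * (Ioc (m.left j) (m.right j)).indicator g x := by
  have hab : a ≤ b := (m.le_left j).trans ((m.left_lt_right j).le.trans (m.right_le j))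
  have hsub : Ioc (m.left j) (m.right j) ⊆ Ioc a b :=
    Ioc_subset_Ioc (m.le_left j) (m.right_le j)
  have e : ∀ x, f x * (Ioc (m.left j) (m.right j)).indicator g x
      = (Ioc (m.left j) (m.right j)).indicator (fun y => f y * g y) x := fun x => by
    by_cases h : x ∈ Ioc (m.left j) (m.right j) <;> simp [h]
  simp only [e]
  rw [intervalIntegral.integral_of_le hab, intervalIntegral.integral_of_le (m.left_lt_right j).le,
    setIntegral_indicator measurableSet_Ioc, inter_eq_right.2 hsub]

theorem memLp_top_indicator {g : ℝ → ℝ} (hg : MemLp g ⊤ volume) {S : Set ℝ}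
    (hS : MeasurableSet S) : MemLp (S.indicator g) ⊤ volume := hg.indicator hS

theorem opK_eq_diffForm (m : Mesh a b) (j : Fin m.N) (v w : ℝ → ℝ) (s : ℝ) :
    m.opK j v w s = diffForm a b v ((Ioc (m.left j) (m.right j)).indicator w) s :=
  integral_cell_eq_integral_indicator m j _ _

section KernelIntegrals

variable {γ : ℝ → ℝ}

theorem integrableOn_kernel (hloc : LocallyIntegrable γ volume) : IntegrableOn γ (Ioc 0 δ) :=
  (hloc.integrableOn_isCompact isCompact_Icc).mono_set Ioc_subset_Icc_self

/-- Bound for the product of the kernel with a quantity of size `s⁻²`. -/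
theorem kernel_mul_le (hγ : ∀ s, 0 ≤ γ s) {A B : ℝ} (hA : 0 ≤ A) (hB : 0 ≤ B) {s X : ℝ}
    (hs : s ∈ Ioc 0 δ) (hX : X ≤ (2 / s * A + B) ^ 2) :
    s ^ 2 * γ s * X ≤ (2 * A + δ * B) ^ 2 * γ s := by
  have h1 : s ^ 2 * X ≤ (2 * A + δ * B) ^ 2 := by
    have h2 : s ^ 2 * X ≤ s ^ 2 * (2 / s * A + B) ^ 2 :=
      mul_le_mul_of_nonneg_left hX (sq_nonneg _)
    have h3 : s ^ 2 * (2 / s * A + B) ^ 2 = (2 * A + s * B) ^ 2 := by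
      have := hs.1.ne'
      field_simp
    have h4 : s * B ≤ δ * B := mul_le_mul_of_nonneg_right hs.2 hB
    have h5 : 0 ≤ s * B := mul_nonneg hs.1.le hB
    exact (h2.trans_eq h3).trans (pow_le_pow_left₀ (by linarith) (by linarith) 2)
  calc s ^ 2 * γ s * X = (s ^ 2 * X) * γ s := by ring
    _ ≤ _ := mul_le_mul_of_nonneg_right h1 (hγ s)

/-- A family of periodic functions `e s`, `0 < s ≤ δ`, with a jointly measurable version, whose
`L²` norm grows at most like `1 / s`. -/
structure IsControlledFamily (a b δ : ℝ) (e : ℝ → ℝ → ℝ) (A B : ℝ) : Prop where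
  nonneg_left : 0 ≤ A
  nonneg_right : 0 ≤ B
  measurable_version : ∃ F : ℝ × ℝ → ℝ, Measurable F ∧
    ∀ s ∈ Ioc 0 δ, e s =ᵐ[volume] fun x => F (s, x)
  memLp_top : ∀ s ∈ Ioc 0 δ, MemLp (e s) ⊤ volume
  periodic : ∀ s ∈ Ioc 0 δ, Function.Periodic (e s) (b - a)
  bound : ∀ s ∈ Ioc 0 δ, ∫ x in a..b, e s x ^ 2 ≤ (2 / s * A + B) ^ 2

variable {e : ℝ → ℝ → ℝ} {A B : ℝ}

theorem IsControlledFamily.aestronglyMeasurable_integral_sq (he : IsControlledFamily a b δ e A B)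
    (hab : a < b) :
    AEStronglyMeasurable (fun s => ∫ x in a..b, e s x ^ 2) (volume.restrict (Ioc 0 δ)) := by
  obtain ⟨F, hF, heF⟩ := he.measurable_version
  have h1 : StronglyMeasurable fun s => ∫ x in Ioc a b, F (s, x) ^ 2 :=
    (hF.pow_const 2).stronglyMeasurable.integral_prod_right (f := fun s x => F (s, x) ^ 2)
  refine h1.aestronglyMeasurable.congr ?_
  filter_upwards [ae_restrict_mem measurableSet_Ioc] with s hs
  rw [← intervalIntegral.integral_of_le hab.le]
  refine intervalIntegral.integral_congr_ae ?_
  filter_upwards [heF s hs] with x hx _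
  rw [hx]

theorem IsControlledFamily.integrableOn_integral_sq (he : IsControlledFamily a b δ e A B)
    (hab : a < b) (hγ : ∀ s, 0 ≤ γ s) (hloc : LocallyIntegrable γ volume) :
    IntegrableOn (fun s => s ^ 2 * γ s * ∫ x in a..b, e s x ^ 2) (Ioc 0 δ) := by
  refine ((integrableOn_kernel hloc).const_mul ((2 * A + δ * B) ^ 2)).mono' ?_ ?_
  · exact ((by fun_prop : Continuous fun s : ℝ => s ^ 2).aestronglyMeasurable.mul
      (integrableOn_kernel hloc).1).mul (he.aestronglyMeasurable_integral_sq hab)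
  · filter_upwards [ae_restrict_mem measurableSet_Ioc] with s hs
    have h0 : 0 ≤ ∫ x in a..b, e s x ^ 2 :=
      intervalIntegral.integral_nonneg hab.le fun x _ => sq_nonneg _
    rw [Real.norm_of_nonneg (mul_nonneg (mul_nonneg (sq_nonneg _) (hγ s)) h0)]
    exact kernel_mul_le hγ he.nonneg_left he.nonneg_right hs (he.bound s hs)

theorem IsControlledFamily.integral_integral_sq_le (he : IsControlledFamily a b δ e A B)
    (hab : a < b) (hδ : 0 < δ) (hγ : ∀ s, 0 ≤ γ s) (hloc : LocallyIntegrable γ volume) :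
    ∫ s in (0 : ℝ)..δ, s ^ 2 * γ s * ∫ x in a..b, e s x ^ 2
      ≤ (2 * A + δ * B) ^ 2 * ∫ s in (0 : ℝ)..δ, γ s := by
  rw [intervalIntegral.integral_of_le hδ.le, intervalIntegral.integral_of_le hδ.le,
    ← integral_const_mul]
  exact setIntegral_mono_on (he.integrableOn_integral_sq hab hγ hloc)
    ((integrableOn_kernel hloc).const_mul _) measurableSet_Ioc fun s hs =>
      kernel_mul_le hγ he.nonneg_left he.nonneg_right hs (he.bound s hs)

/-- The difference quotient contributes `2 / s` and the family `(2 / s) A + B`. The factor `s²`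
cancels both singularities and leaves an integrable multiple of `γ`. -/
theorem IsControlledFamily.abs_kernel_mul_diffForm_le (he : IsControlledFamily a b δ e A B)
    (hab : a < b) (hγ : ∀ s, 0 ≤ γ s) {ρ : ℝ → ℝ} (hρ : MemLp ρ ⊤ volume) {s : ℝ}
    (hs : s ∈ Ioc 0 δ) :
    |s ^ 2 * γ s * diffForm a b (e s) ρ s|
      ≤ 2 * (2 * A + δ * B) * Real.sqrt (∫ x in a..b, ρ x ^ 2) * γ s := by
  have hA := he.nonneg_left
  have hB := he.nonneg_right
  have h1 := abs_integral_diffQuotient_mul_le hab.le (he.memLp_top s hs) (he.periodic s hs) hρ hs.1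
  have hs0 := hs.1
  have h2 : Real.sqrt (∫ x in a..b, e s x ^ 2) ≤ 2 / s * A + B :=
    (Real.sqrt_le_sqrt (he.bound s hs)).trans_eq (Real.sqrt_sq (by positivity))
  set R := Real.sqrt (∫ x in a..b, ρ x ^ 2) with hR
  have hR0 : 0 ≤ R := Real.sqrt_nonneg _
  have h3 : |diffForm a b (e s) ρ s| ≤ 2 / s * (2 / s * A + B) * R :=
    h1.trans (mul_le_mul_of_nonneg_right (mul_le_mul_of_nonneg_left h2 (by positivity)) hR0)
  have h4 : s ^ 2 * |diffForm a b (e s) ρ s| ≤ 2 * (2 * A + δ * B) * R := by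
    calc s ^ 2 * |diffForm a b (e s) ρ s| ≤ s ^ 2 * (2 / s * (2 / s * A + B) * R) :=
          mul_le_mul_of_nonneg_left h3 (sq_nonneg _)
      _ = 2 * (2 * A + s * B) * R := by field_simp
      _ ≤ _ := by
        have : s * B ≤ δ * B := mul_le_mul_of_nonneg_right hs.2 hB
        exact mul_le_mul_of_nonneg_right (by linarith) hR0
  rw [abs_mul, abs_of_nonneg (mul_nonneg (sq_nonneg _) (hγ s))]
  calc s ^ 2 * γ s * |diffForm a b (e s) ρ s| = s ^ 2 * |diffForm a b (e s) ρ s| * γ s := by ring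
    _ ≤ _ := mul_le_mul_of_nonneg_right h4 (hγ s)

theorem IsControlledFamily.integrableOn_diffForm (he : IsControlledFamily a b δ e A B)
    (hab : a < b) (hγ : ∀ s, 0 ≤ γ s) (hloc : LocallyIntegrable γ volume)
    {ρ : ℝ → ℝ} (hρ : MemLp ρ ⊤ volume) :
    IntegrableOn (fun s => s ^ 2 * γ s * diffForm a b (e s) ρ s) (Ioc 0 δ) := by
  refine ((integrableOn_kernel hloc).const_mul
    (2 * (2 * A + δ * B) * Real.sqrt (∫ x in a..b, ρ x ^ 2))).mono' ?_ ?_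
  · refine ((by fun_prop : Continuous fun s : ℝ => s ^ 2).aestronglyMeasurable.mul
      (integrableOn_kernel hloc).1).mul ?_
    obtain ⟨F, hF, heF⟩ := he.measurable_version
    obtain ⟨ρ', hρ', hρe⟩ := hρ.1.aemeasurable
    have hm : Measurable fun p : ℝ × ℝ =>
        1 / p.1 * (F (p.1, p.2) - F (p.1, p.2 - p.1)) * ρ' p.2 := by
      have h1 : Measurable fun p : ℝ × ℝ => F (p.1, p.2 - p.1) :=
        hF.comp (measurable_fst.prodMk (measurable_snd.sub measurable_fst))
      have h2 : Measurable fun p : ℝ × ℝ => 1 / p.1 := measurable_fst.const_div 1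
      exact (h2.mul (hF.sub h1)).mul (hρ'.comp measurable_snd)
    have h1 : StronglyMeasurable fun s =>
        ∫ x in Ioc a b, 1 / s * (F (s, x) - F (s, x - s)) * ρ' x :=
      hm.stronglyMeasurable.integral_prod_right
        (f := fun s x => 1 / s * (F (s, x) - F (s, x - s)) * ρ' x)
    refine h1.aestronglyMeasurable.congr ?_
    filter_upwards [ae_restrict_mem measurableSet_Ioc] with s hs
    rw [diffForm_congr_ae (heF s hs), diffForm, ← intervalIntegral.integral_of_le hab.le]
    refine intervalIntegral.integral_congr_ae ?_
    filter_upwards [hρe] with x hx _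
    rw [hx]
  · filter_upwards [ae_restrict_mem measurableSet_Ioc] with s hs
    exact he.abs_kernel_mul_diffForm_le hab hγ hρ hs

theorem IsControlledFamily.abs_integral_diffForm_le (he : IsControlledFamily a b δ e A B)
    (hab : a < b) (hδ : 0 < δ) (hγ : ∀ s, 0 ≤ γ s) (hloc : LocallyIntegrable γ volume)
    {ρ : ℝ → ℝ} (hρ : MemLp ρ ⊤ volume) :
    |∫ s in (0 : ℝ)..δ, s ^ 2 * γ s * diffForm a b (e s) ρ s|
      ≤ 2 * (2 * A + δ * B) * Real.sqrt (∫ x in a..b, ρ x ^ 2) * ∫ s in (0 : ℝ)..δ, γ s := by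
  rw [intervalIntegral.integral_of_le hδ.le, intervalIntegral.integral_of_le hδ.le,
    ← integral_const_mul, ← Real.norm_eq_abs]
  refine norm_integral_le_of_norm_le ((integrableOn_kernel hloc).const_mul _) ?_
  filter_upwards [ae_restrict_mem measurableSet_Ioc] with s hs
  exact he.abs_kernel_mul_diffForm_le hab hγ hρ hs

/-- Fubini's theorem for the nonlocal operator applied to a bounded continuous function. -/
theorem integral_nonlocal_mul (hab : a < b) (hδ : 0 < δ) (hloc : LocallyIntegrable γ volume)
    {U : ℝ → ℝ} (hU : Continuous U) (hp : Function.Periodic U (b - a)) {ρ : ℝ → ℝ}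
    (hρ : MemLp ρ ⊤ volume) :
    IntegrableOn (fun s => s ^ 2 * γ s *
      diffForm a b (fun x => 1 / s * (U (x + s) - U x)) ρ s) (Ioc 0 δ) ∧
    ∫ x in a..b, (∫ s in (0 : ℝ)..δ, s ^ 2 * γ s * (1 / s * (1 / s * (U (x + s) - U x)
        - 1 / s * (U (x - s + s) - U (x - s))))) * ρ x
      = ∫ s in (0 : ℝ)..δ, s ^ 2 * γ s *
        diffForm a b (fun x => 1 / s * (U (x + s) - U x)) ρ s := by
  -- After cancelling `s²` the integrand is this bounded second difference times `γ(s) ρ(x)`, which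
  -- is integrable on the product.
  set D : ℝ × ℝ → ℝ := fun p => U (p.2 + p.1) - 2 * U p.2 + U (p.2 - p.1) with hD
  have hDc : Continuous D := by fun_prop
  obtain ⟨C, hC⟩ := isCompact_Icc.exists_bound_of_continuousOn (s := Icc 0 (b - a)) hU.continuousOn
  have hCU : ∀ x, |U x| ≤ C := fun x => by
    obtain ⟨y, hy, hxy⟩ := hp.exists_mem_Ico₀ (sub_pos.2 hab) x
    rw [hxy]
    exact hC y (Ico_subset_Icc_self hy)
  have hDb : ∀ p, ‖D p‖ ≤ 4 * C := fun p => by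
    have h1 := abs_le.1 (hCU (p.2 + p.1))
    have h2 := abs_le.1 (hCU p.2)
    have h3 := abs_le.1 (hCU (p.2 - p.1))
    rw [Real.norm_eq_abs, abs_le]
    simp only [hD]
    constructor <;> linarith [h1.1, h1.2, h2.1, h2.2, h3.1, h3.2]
  have hρi : IntegrableOn ρ (Ioc a b) :=
    (intervalIntegrable_iff_integrableOn_Ioc_of_le hab.le).1 (intervalIntegrable_of_memLp_top hρ a b)
  have hint : Integrable (fun p : ℝ × ℝ => D p * (γ p.1 * ρ p.2))
      ((volume.restrict (Ioc 0 δ)).prod (volume.restrict (Ioc a b))) :=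
    ((integrableOn_kernel hloc).mul_prod hρi).bdd_mul hDc.aestronglyMeasurable (.of_forall hDb)
  have hpt : ∀ s ∈ Ioc 0 δ, ∀ x, s ^ 2 * γ s * (1 / s * (1 / s * (U (x + s) - U x)
        - 1 / s * (U (x - s + s) - U (x - s)))) = D (s, x) * γ s := fun s hs x => by
    have := hs.1.ne'
    simp only [hD, sub_add_cancel]
    field_simp
    ring
  have hform : ∀ s ∈ Ioc 0 δ, ∫ x in Ioc a b, D (s, x) * (γ s * ρ x)
      = s ^ 2 * γ s * diffForm a b (fun x => 1 / s * (U (x + s) - U x)) ρ s := fun s hs => by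
    rw [diffForm, intervalIntegral.integral_of_le hab.le, ← integral_const_mul]
    congr 1
    ext x
    rw [← mul_assoc, ← hpt s hs x]
    ring
  constructor
  · refine IntegrableOn.congr_fun (f := fun s => ∫ x in Ioc a b, D (s, x) * (γ s * ρ x))
      hint.integral_prod_left (fun s hs => hform s hs) measurableSet_Ioc
  · rw [intervalIntegral.integral_of_le hδ.le, ← setIntegral_congr_fun measurableSet_Ioc hform,
      integral_integral_swap hint, intervalIntegral.integral_of_le hab.le]
    congr 1
    ext x
    rw [intervalIntegral.integral_of_le hδ.le, ← integral_mul_const]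
    refine setIntegral_congr_fun measurableSet_Ioc fun s hs => ?_
    rw [hpt s hs x, mul_assoc]

end KernelIntegrals

end NonlocalDG

namespace NonlocalDG

open MeasureTheory Set Filter Topology

/-! ### Grönwall's inequality -/

section Gronwall

/-- Grönwall's inequality for a second order system with vanishing initial data, the equation
holding in the interior only. -/
theorem norm_le_of_second_order_bound {E : Type*} [NormedAddCommGroup E] [NormedSpace ℝ E]
    {T K ε : ℝ} (hK : 1 ≤ K) (hε : 0 ≤ ε) {c d g : ℝ → E}
    (hc : ContinuousOn c (Icc 0 T)) (hd : ContinuousOn d (Icc 0 T))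
    (hcd : ∀ t ∈ Ioo 0 T, HasDerivAt c (d t) t) (hdg : ∀ t ∈ Ioo 0 T, HasDerivAt d (g t) t)
    (hc0 : c 0 = 0) (hd0 : d 0 = 0) (hg : ∀ t ∈ Ioo 0 T, ‖g t‖ ≤ K * ‖c t‖ + ε) :
    ∀ t ∈ Icc 0 T, ‖c t‖ ≤ ε * Real.exp (K * T) ∧ ‖d t‖ ≤ ε * Real.exp (K * T) := by
  intro t ht
  have hK0 : 0 < K := zero_lt_one.trans_le hK
  have hT : 0 ≤ T := ht.1.trans ht.2
  suffices h : ‖(c t, d t)‖ ≤ ε * Real.exp (K * T) from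
    ⟨(norm_fst_le (c t, d t)).trans h, (norm_snd_le (c t, d t)).trans h⟩
  rcases ht.1.eq_or_lt with h0 | h0
  · rw [← h0, hc0, hd0]
    simp only [Prod.mk_zero_zero, norm_zero]
    positivity
  have hy : ContinuousOn (fun τ => (c τ, d τ)) (Icc 0 T) := hc.prodMk hd
  -- The equation is not available at time `0`, so the estimate starts from `t₀ > 0` and `t₀ → 0` is
  -- taken afterwards, using continuity and the vanishing data.
  have hstep : ∀ t₀ ∈ Ioo 0 t,
      ‖(c t, d t)‖ ≤ ‖(c t₀, d t₀)‖ * Real.exp (K * T) + ε * Real.exp (K * T) := by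
    intro t₀ ht₀
    have hsub : Ico t₀ t ⊆ Ioo 0 T := fun τ hτ =>
      ⟨ht₀.1.trans_le hτ.1, hτ.2.trans_le ht.2⟩
    have h := norm_le_gronwallBound_of_norm_deriv_right_le (f := fun τ => (c τ, d τ))
      (f' := fun τ => (d τ, g τ)) (δ := ‖(c t₀, d t₀)‖) (K := K) (ε := ε) (a := t₀) (b := t)
      (hy.mono (Icc_subset_Icc ht₀.1.le ht.2))
      (fun τ hτ => ((hcd τ (hsub hτ)).prodMk (hdg τ (hsub hτ))).hasDerivWithinAt) le_rfl
      (fun τ hτ => by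
        have h1 : ‖c τ‖ ≤ ‖(c τ, d τ)‖ := norm_fst_le (c τ, d τ)
        have h2 : ‖d τ‖ ≤ ‖(c τ, d τ)‖ := norm_snd_le (c τ, d τ)
        have h3 := hg τ (hsub hτ)
        have h4 : K * ‖c τ‖ ≤ K * ‖(c τ, d τ)‖ := mul_le_mul_of_nonneg_left h1 hK0.le
        -- In the maximum norm the component `c' = d` has rate `1`, which `K ≥ 1` absorbs.
        have h5 : 1 * ‖(c τ, d τ)‖ ≤ K * ‖(c τ, d τ)‖ :=
          mul_le_mul_of_nonneg_right hK (norm_nonneg _)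
        rw [Prod.norm_def (d τ, g τ)]
        exact max_le (by linarith) (by linarith)) t ⟨ht₀.2.le, le_rfl⟩
    rw [gronwallBound_of_K_ne_0 hK0.ne'] at h
    have h1 : Real.exp (K * (t - t₀)) ≤ Real.exp (K * T) :=
      Real.exp_le_exp.2 (mul_le_mul_of_nonneg_left (by linarith [ht.2, ht₀.1]) hK0.le)
    have h2 : ε / K ≤ ε := div_le_self hε hK
    have h3 : 0 ≤ ε / K := div_nonneg hε hK0.le
    have h4 : ε / K * (Real.exp (K * (t - t₀)) - 1) ≤ ε * Real.exp (K * T) :=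
      (mul_le_mul_of_nonneg_left (by linarith) h3).trans
        (mul_le_mul_of_nonneg_right h2 (Real.exp_pos _).le)
    exact h.trans (add_le_add (mul_le_mul_of_nonneg_left h1 (norm_nonneg _)) h4)
  have hlim : Tendsto (fun t₀ => ‖(c t₀, d t₀)‖ * Real.exp (K * T) + ε * Real.exp (K * T))
      (𝓝[Ioo 0 t] 0) (𝓝 (0 * Real.exp (K * T) + ε * Real.exp (K * T))) := by
    have h1 : Tendsto (fun τ => (c τ, d τ)) (𝓝[Ioo 0 t] 0) (𝓝 (c 0, d 0)) :=
      (hy 0 ⟨le_rfl, hT⟩).mono_left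
        (nhdsWithin_mono _ fun τ hτ => ⟨hτ.1.le, hτ.2.le.trans ht.2⟩)
    rw [hc0, hd0] at h1
    have h2 := h1.norm
    rw [Prod.mk_zero_zero, norm_zero] at h2
    exact (h2.mul_const _).add_const _
  have : (𝓝[Ioo 0 t] (0 : ℝ)).NeBot := by
    rw [nhdsWithin_Ioo_eq_nhdsGT h0]; infer_instance
  have h := ge_of_tendsto hlim (by filter_upwards [self_mem_nhdsWithin] with τ hτ using hstep τ hτ)
  simpa using h

end Gronwall

variable {a b δ : ℝ} {m : Mesh a b} {k n : ℕ} {φ : Fin n → ℝ → ℝ}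

theorem Mesh.integral_eq_of_forall_cell (m : Mesh a b) {f g : ℝ → ℝ}
    (hf : IntervalIntegrable f volume a b) (hg : IntervalIntegrable g volume a b)
    (h : ∀ j, ∫ x in (m.left j)..(m.right j), f x = ∫ x in (m.left j)..(m.right j), g x) :
    ∫ x in a..b, f x = ∫ x in a..b, g x := by
  rw [← m.sum_integral_cell hf, ← m.sum_integral_cell hg]
  exact Finset.sum_congr rfl fun j _ => h j

theorem memLp_top_diffQuotient {f : ℝ → ℝ} (hf : MemLp f ⊤ volume) (s : ℝ) :
    MemLp (fun x => 1 / s * (f (x + s) - f x)) ⊤ volume :=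
  ((memLp_top_comp_add hf s).sub hf).const_mul _

theorem periodic_diffQuotient {f : ℝ → ℝ} {c : ℝ} (hf : Function.Periodic f c) (s : ℝ) :
    Function.Periodic (fun x => 1 / s * (f (x + s) - f x)) c := fun x => by
  simp only [add_right_comm x c s, hf x, hf (x + s)]

/-! ### The error equations at a fixed time -/

section FixedTime

variable {U V : ℝ → ℝ} {Q : ℝ → ℝ → ℝ}

theorem integral_auxiliary (hab : a < b) (hV : V ∈ m.dgSpace k)
    (hQ : ∀ s ∈ Ioc 0 δ, Q s ∈ m.dgSpace k)
    (haux : ∀ s ∈ Ioc 0 δ, ∀ j, ∀ w ∈ m.dgSpace k,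
      (∫ x in (m.left j)..(m.right j), Q s x * w x) - m.opH j V w s = 0)
    {s : ℝ} (hs : s ∈ Ioc 0 δ) {w : ℝ → ℝ} (hw : w ∈ m.dgSpace k) :
    ∫ x in a..b, Q s x * w x = ∫ x in a..b, 1 / s * (V (x + s) - V x) * w x := by
  have hVt := m.memLp_top_of_mem_dgSpace hab hV
  have hQt := m.memLp_top_of_mem_dgSpace hab (hQ s hs)
  have hwt := m.memLp_top_of_mem_dgSpace hab hw
  exact m.integral_eq_of_forall_cell
    (intervalIntegrable_of_memLp_top (memLp_top_mul hQt hwt) a b)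
    (intervalIntegrable_of_memLp_top (memLp_top_mul (memLp_top_diffQuotient hVt s) hwt) a b)
    fun j => sub_eq_zero.1 (haux s hs j w hw)

/-- No measurability of `q_h` in `s` is assumed. The auxiliary equation expresses the coordinates of
`Q s` as integrals of the difference quotient of `V`, and these are measurable in `s` once `V` is
replaced by its Borel representative. -/
theorem exists_measurable_version (hab : a < b) (hφ : m.IsOrthonormalBasis k φ)
    (hU : Continuous U) (hV : V ∈ m.dgSpace k)
    (hQ : ∀ s ∈ Ioc 0 δ, Q s ∈ m.dgSpace k)
    (haux : ∀ s ∈ Ioc 0 δ, ∀ j, ∀ w ∈ m.dgSpace k,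
      (∫ x in (m.left j)..(m.right j), Q s x * w x) - m.opH j V w s = 0) :
    ∃ F : ℝ × ℝ → ℝ, Measurable F ∧ ∀ s ∈ Ioc 0 δ,
      (fun x => Q s x - 1 / s * (U (x + s) - U x)) =ᵐ[volume] fun x => F (s, x) := by
  set V' : ℝ → ℝ := fun x => ∑ i, (∫ y in a..b, V y * φ i y) * φ i x with hV'
  have hV'm : Measurable V' :=
    Finset.measurable_sum _ fun i _ => (hφ.measurable i).const_mul _
  have hVV' : V =ᵐ[volume] V' := hφ.expand V hV
  have hinv : Measurable fun p : ℝ × ℝ => 1 / p.1 := measurable_fst.const_div 1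
  have hadd : Measurable fun p : ℝ × ℝ => p.2 + p.1 := measurable_snd.add measurable_fst
  have hβ : ∀ i, Measurable fun s => ∫ x in Ioc a b, 1 / s * (V' (x + s) - V' x) * φ i x :=
    fun i => by
      have hm : Measurable fun p : ℝ × ℝ => 1 / p.1 * (V' (p.2 + p.1) - V' p.2) * φ i p.2 :=
        (hinv.mul ((hV'm.comp hadd).sub (hV'm.comp measurable_snd))).mul
          ((hφ.measurable i).comp measurable_snd)
      exact (hm.stronglyMeasurable.integral_prod_right
        (f := fun s x => 1 / s * (V' (x + s) - V' x) * φ i x)).measurable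
  refine ⟨fun p => (∑ i, (∫ x in Ioc a b, 1 / p.1 * (V' (x + p.1) - V' x) * φ i x) * φ i p.2)
    - 1 / p.1 * (U (p.2 + p.1) - U p.2), ?_, fun s hs => ?_⟩
  · refine (Finset.measurable_sum _ fun i _ => ((hβ i).comp measurable_fst).mul
      ((hφ.measurable i).comp measurable_snd)).sub ?_
    exact hinv.mul ((hU.measurable.comp hadd).sub (hU.measurable.comp measurable_snd))
  · filter_upwards [hφ.expand _ (hQ s hs)] with x hx
    rw [hx]
    congr 1
    refine Finset.sum_congr rfl fun i _ => ?_
    rw [integral_auxiliary hab hV hQ haux hs (hφ.mem i), ← intervalIntegral.integral_of_le hab.le]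
    congr 1
    refine intervalIntegral.integral_congr_ae ?_
    filter_upwards [hVV',
      (measurePreserving_add_right volume s).quasiMeasurePreserving.ae_eq_comp hVV'] with y h1 h2 _
    simp only [Function.comp_apply] at h2
    rw [h1, h2]

theorem integral_sub_sq_le_add_sq (hab : a < b) (hφ : m.IsOrthonormalBasis k φ)
    {v f : ℝ → ℝ} (hv : v ∈ m.dgSpace k) (hf : ContDiff ℝ ((k + 1 : ℕ) : WithTop ℕ∞) f)
    (hp : Function.Periodic f (b - a)) {Γ M : ℝ} (hΓ : 0 ≤ Γ) (hM : 0 ≤ M)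
    (hsum : ∑ i, (∫ x in a..b, (v x - f x) * φ i x) ^ 2 ≤ Γ ^ 2)
    (hD : ∫ x in a..b, iteratedDeriv (k + 1) f x ^ 2 ≤ M ^ 2) (hsize : 0 ≤ m.size) :
    ∫ x in a..b, (v x - f x) ^ 2 ≤ (Γ + m.size ^ (k + 1) * M) ^ 2 := by
  have h1 := hφ.integral_sub_sq_le hab hv hf hp
  have h2 : m.size ^ (2 * k + 2) * ∫ x in a..b, iteratedDeriv (k + 1) f x ^ 2
      ≤ m.size ^ (2 * k + 2) * M ^ 2 := mul_le_mul_of_nonneg_left hD (by positivity)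
  have h3 : m.size ^ (2 * k + 2) * M ^ 2 = (m.size ^ (k + 1) * M) ^ 2 := by ring
  have h4 : 0 ≤ Γ * (m.size ^ (k + 1) * M) := by positivity
  nlinarith

/-- The constant `A` bounds `‖V - U‖`: projected part `Γ` plus approximation error of `U`. The
constant `B` is the approximation error of `q`. The projected part of the flux error is, by the
auxiliary equation and Bessel, at most the difference quotient of `V - U`, hence `(2 / s) A`. -/
theorem isControlledFamily_error (hab : a < b) (hδ : 0 < δ) (hφ : m.IsOrthonormalBasis k φ)
    (hsize : 0 ≤ m.size)
    (hU : ContDiff ℝ ((k + 2 : ℕ) : WithTop ℕ∞) U) (hp : Function.Periodic U (b - a))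
    (hV : V ∈ m.dgSpace k) (hQ : ∀ s ∈ Ioc 0 δ, Q s ∈ m.dgSpace k)
    (haux : ∀ s ∈ Ioc 0 δ, ∀ j, ∀ w ∈ m.dgSpace k,
      (∫ x in (m.left j)..(m.right j), Q s x * w x) - m.opH j V w s = 0)
    {Γ M : ℝ} (hΓ : 0 ≤ Γ) (hM : 0 ≤ M)
    (hsum : ∑ i, (∫ x in a..b, (V x - U x) * φ i x) ^ 2 ≤ Γ ^ 2)
    (hq : ∀ s ∈ Ioc 0 δ, hSeminorm a b (k + 1) (fun x => 1 / s * (U (x + s) - U x)) ≤ M) :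
    IsControlledFamily a b δ (fun s x => Q s x - 1 / s * (U (x + s) - U x))
      (Γ + m.size ^ (k + 1) * ((b - a) * M)) (m.size ^ (k + 1) * M) := by
  have hba : 0 < b - a := sub_pos.2 hab
  have hU1 : ContDiff ℝ ((k + 1 : ℕ) : WithTop ℕ∞) U := hU.of_le (by exact_mod_cast by omega)
  have hUt : MemLp U ⊤ volume := memLp_top_of_continuous_periodic hba hU.continuous hp
  have hVt : MemLp V ⊤ volume := m.memLp_top_of_mem_dgSpace hab hV
  have hQt : ∀ s ∈ Ioc 0 δ, MemLp (Q s) ⊤ volume := fun s hs =>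
    m.memLp_top_of_mem_dgSpace hab (hQ s hs)
  have hA : 0 ≤ Γ + m.size ^ (k + 1) * ((b - a) * M) := by positivity
  have herr : ∫ x in a..b, (V x - U x) ^ 2 ≤ (Γ + m.size ^ (k + 1) * ((b - a) * M)) ^ 2 :=
    integral_sub_sq_le_add_sq hab hφ hV hU1 hp hΓ (by positivity) hsum
      (by rw [mul_pow]; exact integral_iteratedDeriv_sq_le_of_diffQuotient hab hδ hU hp hq) hsize
  refine ⟨hA, by positivity, exists_measurable_version hab hφ hU.continuous hV hQ haux,
    fun s hs => (hQt s hs).sub (memLp_top_diffQuotient hUt s),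
    fun s hs => (hQ s hs).1.sub (periodic_diffQuotient hp s), fun s hs => ?_⟩
  have hs0 := hs.1
  have hqc : ContDiff ℝ ((k + 1 : ℕ) : WithTop ℕ∞) fun x => 1 / s * (U (x + s) - U x) :=
    contDiff_const.mul ((hU1.comp (by fun_prop)).sub hU1)
  have hgt : MemLp (fun x => V x - U x) ⊤ volume := hVt.sub hUt
  have hgp : Function.Periodic (fun x => V x - U x) (b - a) := hV.1.sub hp
  refine integral_sub_sq_le_add_sq hab hφ (hQ s hs) hqc (periodic_diffQuotient hp s)
    (by positivity) hM ?_ (integral_sq_le_of_hSeminorm_le hab.le (hq s hs)) hsize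
  have hcoef : ∀ i, ∫ x in a..b, (Q s x - 1 / s * (U (x + s) - U x)) * φ i x
      = ∫ x in a..b, (1 / s * ((V (x + s) - U (x + s)) - (V x - U x))) * φ i x := by
    intro i
    have hi := hφ.memLp_top hab i
    have e1 : ∫ x in a..b, (Q s x - 1 / s * (U (x + s) - U x)) * φ i x
        = (∫ x in a..b, Q s x * φ i x) - ∫ x in a..b, 1 / s * (U (x + s) - U x) * φ i x := by
      rw [← intervalIntegral.integral_sub
        (intervalIntegrable_of_memLp_top (memLp_top_mul (hQt s hs) hi) a b)
        (intervalIntegrable_of_memLp_top (memLp_top_mul (memLp_top_diffQuotient hUt s) hi) a b)]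
      congr 1; ext x; ring
    rw [e1, integral_auxiliary hab hV hQ haux hs (hφ.mem i), ← intervalIntegral.integral_sub
      (intervalIntegrable_of_memLp_top (memLp_top_mul (memLp_top_diffQuotient hVt s) hi) a b)
      (intervalIntegrable_of_memLp_top (memLp_top_mul (memLp_top_diffQuotient hUt s) hi) a b)]
    congr 1; ext x; ring
  simp only [hcoef]
  refine (hφ.sum_sq_le hab (memLp_top_diffQuotient hgt s)).trans ?_
  have e2 : ∫ x in a..b, (1 / s * ((V (x + s) - U (x + s)) - (V x - U x))) ^ 2
      = (1 / s) ^ 2 * ∫ x in a..b, ((V (x + s) - U (x + s)) - (V x - U x)) ^ 2 := by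
    rw [← intervalIntegral.integral_const_mul]; congr 1; ext x; ring
  rw [e2]
  have h5 := (integral_shift_sub_sq_le hab.le hgt hgp s).trans
    (mul_le_mul_of_nonneg_left herr (by norm_num))
  refine (mul_le_mul_of_nonneg_left h5 (by positivity)).trans_eq ?_
  ring

/-- Subtract the exact equation, integrated by Fubini against the truncated test function, from the
discrete one on each cell; then sum over the cells. -/
theorem integral_wave_error_mul (hab : a < b) (hδ : 0 < δ) {γ : ℝ → ℝ} (hγ : ∀ s, 0 ≤ γ s)
    (hloc : LocallyIntegrable γ volume) (hU : Continuous U) (hp : Function.Periodic U (b - a))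
    {A B : ℝ}
    (he : IsControlledFamily a b δ (fun s x => Q s x - 1 / s * (U (x + s) - U x)) A B)
    {W Z r : ℝ → ℝ} (hW : MemLp W ⊤ volume) (hZ : MemLp Z ⊤ volume) (hr : MemLp r ⊤ volume)
    (hwaveh : ∀ j, (∫ x in (m.left j)..(m.right j), W x * r x)
      - 2 * ∫ s in (0 : ℝ)..δ, s ^ 2 * γ s * m.opK j (Q s) r s = 0)
    (hwave : ∀ x ∈ Ioo a b, Z x - 2 * ∫ s in (0 : ℝ)..δ, s ^ 2 * γ s *
      (1 / s * (1 / s * (U (x + s) - U x) - 1 / s * (U (x - s + s) - U (x - s)))) = 0) :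
    ∫ x in a..b, (W x - Z x) * r x = 2 * ∫ s in (0 : ℝ)..δ, s ^ 2 * γ s *
      diffForm a b (fun x => Q s x - 1 / s * (U (x + s) - U x)) r s := by
  have hUt : MemLp U ⊤ volume :=
    memLp_top_of_continuous_periodic (sub_pos.2 hab) hU hp
  set ρ : Fin m.N → ℝ → ℝ := fun j => (Ioc (m.left j) (m.right j)).indicator r with hρ
  have hρt : ∀ j, MemLp (ρ j) ⊤ volume := fun j => memLp_top_indicator hr measurableSet_Ioc
  have hcell : ∀ j, ∫ x in (m.left j)..(m.right j), (W x - Z x) * r x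
      = 2 * ∫ s in (0 : ℝ)..δ, s ^ 2 * γ s *
        diffForm a b (fun x => Q s x - 1 / s * (U (x + s) - U x)) (ρ j) s := by
    intro j
    obtain ⟨hqi, hqe⟩ := integral_nonlocal_mul hab hδ hloc hU hp (hρt j)
    have hei := he.integrableOn_diffForm hab hγ hloc (hρt j)
    have hZρ : ∫ x in a..b, Z x * ρ j x = 2 * ∫ s in (0 : ℝ)..δ, s ^ 2 * γ s *
        diffForm a b (fun x => 1 / s * (U (x + s) - U x)) (ρ j) s := by
      rw [← hqe, ← intervalIntegral.integral_const_mul]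
      refine integral_congr_of_eqOn_Ioo hab.le fun x hx => ?_
      rw [sub_eq_zero.1 (hwave x hx), mul_assoc]
    have hWρ := sub_eq_zero.1 (hwaveh j)
    -- Splitting `Q = e_q + q` under the integral in `s` is legitimate because both parts have been
    -- shown integrable.
    have hsplit : ∫ s in (0 : ℝ)..δ, s ^ 2 * γ s * m.opK j (Q s) r s
        = (∫ s in (0 : ℝ)..δ, s ^ 2 * γ s *
            diffForm a b (fun x => Q s x - 1 / s * (U (x + s) - U x)) (ρ j) s)
          + ∫ s in (0 : ℝ)..δ, s ^ 2 * γ s *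
            diffForm a b (fun x => 1 / s * (U (x + s) - U x)) (ρ j) s := by
      rw [intervalIntegral.integral_of_le hδ.le, intervalIntegral.integral_of_le hδ.le,
        intervalIntegral.integral_of_le hδ.le, ← integral_add hei hqi]
      refine setIntegral_congr_fun measurableSet_Ioc fun s hs => ?_
      rw [← mul_add, ← diffForm_add (he.memLp_top s hs) (memLp_top_diffQuotient hUt s) (hρt j),
        opK_eq_diffForm]
      simp only [sub_add_cancel, hρ]
    have e : ∫ x in (m.left j)..(m.right j), (W x - Z x) * r x
        = (∫ x in (m.left j)..(m.right j), W x * r x)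
          - ∫ x in (m.left j)..(m.right j), Z x * r x := by
      rw [← intervalIntegral.integral_sub
        (intervalIntegrable_of_memLp_top (memLp_top_mul hW hr) _ _)
        (intervalIntegrable_of_memLp_top (memLp_top_mul hZ hr) _ _)]
      congr 1; ext x; ring
    rw [e, hWρ, hsplit, integral_cell_eq_integral_indicator m j Z r, hZρ]
    ring
  have hWZ : IntervalIntegrable (fun x => (W x - Z x) * r x) volume a b :=
    intervalIntegrable_of_memLp_top (memLp_top_mul (hW.sub hZ) hr) a b
  rw [← m.sum_integral_cell hWZ]
  simp only [hcell]
  rw [← Finset.mul_sum, ← intervalIntegral.integral_finsetSum fun j _ =>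
    (intervalIntegrable_iff_integrableOn_Ioc_of_le hδ.le).2
      (he.integrableOn_diffForm hab hγ hloc (hρt j)), intervalIntegral.integral_of_le hδ.le,
    intervalIntegral.integral_of_le hδ.le]
  congr 1
  refine setIntegral_congr_fun measurableSet_Ioc fun s hs => ?_
  rw [← Finset.mul_sum]
  congr 1
  rw [diffForm, ← m.sum_integral_cell (intervalIntegrable_diffForm (he.memLp_top s hs) hr s)]
  exact Finset.sum_congr rfl fun j _ => (integral_cell_eq_integral_indicator m j _ _).symm

/-- The second time derivative of the projected error is controlled by the error itself. -/
theorem norm_acceleration_le (hab : a < b) (hδ : 0 < δ) (hφ : m.IsOrthonormalBasis k φ)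
    {γ : ℝ → ℝ} (hγ : ∀ s, 0 ≤ γ s)
    (hloc : LocallyIntegrable γ volume) (hU : Continuous U) (hp : Function.Periodic U (b - a))
    {A B : ℝ}
    (he : IsControlledFamily a b δ (fun s x => Q s x - 1 / s * (U (x + s) - U x)) A B)
    {W Z : ℝ → ℝ} (hW : MemLp W ⊤ volume) (hZ : MemLp Z ⊤ volume)
    (hwaveh : ∀ j, ∀ r ∈ m.dgSpace k, (∫ x in (m.left j)..(m.right j), W x * r x)
      - 2 * ∫ s in (0 : ℝ)..δ, s ^ 2 * γ s * m.opK j (Q s) r s = 0)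
    (hwave : ∀ x ∈ Ioo a b, Z x - 2 * ∫ s in (0 : ℝ)..δ, s ^ 2 * γ s *
      (1 / s * (1 / s * (U (x + s) - U x) - 1 / s * (U (x - s + s) - U (x - s)))) = 0) :
    ‖WithLp.toLp 2 (fun i => ∫ x in a..b, (W x - Z x) * φ i x)‖
      ≤ 4 * (2 * A + δ * B) * ∫ s in (0 : ℝ)..δ, γ s := by
  set g : Fin n → ℝ := fun i => ∫ x in a..b, (W x - Z x) * φ i x with hg
  -- The test function is the projection of `W - Z` itself, so that the error equation computes
  -- `‖g‖²`; one factor `‖g‖` is divided out at the end.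
  set r : ℝ → ℝ := fun x => ∑ i, g i * φ i x with hr
  have hrmem : r ∈ m.dgSpace k := m.sum_smul_mem_dgSpace _ g hφ.mem
  have hrt : MemLp r ⊤ volume := hφ.sum_memLp_top hab g
  have hG : 0 ≤ ∫ s in (0 : ℝ)..δ, γ s := intervalIntegral.integral_nonneg hδ.le fun s _ => hγ s
  have hnorm : ‖WithLp.toLp 2 g‖ ^ 2 = ∑ i, g i ^ 2 := by
    rw [EuclideanSpace.norm_sq_eq]
    simp
  have hr2 : Real.sqrt (∫ x in a..b, r x ^ 2) = ‖WithLp.toLp 2 g‖ := by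
    rw [hφ.integral_sum_sq hab g, ← hnorm, Real.sqrt_sq (norm_nonneg _)]
  have h1 : ‖WithLp.toLp 2 g‖ ^ 2 = ∫ x in a..b, (W x - Z x) * r x := by
    have hWZ : MemLp (fun x => W x - Z x) ⊤ volume := hW.sub hZ
    rw [hnorm, hφ.integral_mul_sum hab g hWZ]
    exact Finset.sum_congr rfl fun i _ => by rw [pow_two]
  rw [integral_wave_error_mul hab hδ hγ hloc hU hp he hW hZ hrt
    (fun j => hwaveh j r hrmem) hwave] at h1
  have h2 := (le_abs_self _).trans (he.abs_integral_diffForm_le hab hδ hγ hloc hrt)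
  rw [hr2] at h2
  have hA := he.nonneg_left
  have hB := he.nonneg_right
  rcases (norm_nonneg (WithLp.toLp 2 g)).eq_or_lt with h0 | h0
  · rw [← h0]; positivity
  · refine le_of_mul_le_mul_right ?_ h0
    calc ‖WithLp.toLp 2 g‖ * ‖WithLp.toLp 2 g‖ = ‖WithLp.toLp 2 g‖ ^ 2 := (pow_two _).symm
      _ ≤ _ := by rw [h1]; linarith

end FixedTime

end NonlocalDG

/-! ### Evolution of the projected error -/

namespace NonlocalDG

open MeasureTheory Set Filter Topology

theorem hasDerivAt_toLp {n : ℕ} {f : ℝ → Fin n → ℝ} {f' : Fin n → ℝ} {t : ℝ}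
    (h : ∀ i, HasDerivAt (fun τ => f τ i) (f' i) t) :
    HasDerivAt (fun τ => WithLp.toLp 2 (f τ)) (WithLp.toLp 2 f') t :=
  (PiLp.continuousLinearEquiv 2 ℝ fun _ : Fin n => ℝ).symm.toContinuousLinearMap.hasFDerivAt
    |>.comp_hasDerivAt t (hasDerivAt_pi.2 h)

theorem continuousOn_toLp {n : ℕ} {f : ℝ → Fin n → ℝ} {S : Set ℝ}
    (h : ∀ i, ContinuousOn (fun τ => f τ i) S) :
    ContinuousOn (fun τ => WithLp.toLp 2 (f τ)) S :=
  (PiLp.continuous_toLp 2 _).comp_continuousOn (continuousOn_pi.2 h)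

variable {a b T δ : ℝ} {γ : ℝ → ℝ} {u : ℝ → ℝ → ℝ} {q : ℝ → ℝ → ℝ → ℝ} {m : Mesh a b} {k n : ℕ}
  {uh : ℝ → ℝ → ℝ} {qh : ℝ → ℝ → ℝ → ℝ} {φ : Fin n → ℝ → ℝ}

theorem Mesh.size_nonneg (m : Mesh a b) : 0 ≤ m.size :=
  Real.iSup_nonneg fun j => (sub_pos.2 (m.left_lt_right j)).le

theorem Mesh.IsDGSolution.differentiableOn (h : m.IsDGSolution T δ k γ uh qh) (j : Fin m.N)
    {x : ℝ} (hx : x ∈ m.cell j) : DifferentiableOn ℝ (fun t => uh x t) (Icc 0 T) :=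
  (h.time_smooth j x hx).differentiableOn two_ne_zero

theorem Mesh.IsDGSolution.differentiableOn_dt (h : m.IsDGSolution T δ k γ uh qh) (hT : 0 < T)
    (j : Fin m.N) {x : ℝ} (hx : x ∈ m.cell j) :
    DifferentiableOn ℝ (fun t => dt T uh x t) (Icc 0 T) :=
  ((h.time_smooth j x hx).derivWithin (uniqueDiffOn_Icc hT) (m := 1)
    (by norm_num)).differentiableOn one_ne_zero

theorem Mesh.IsDGSolution.dt_mem (h : m.IsDGSolution T δ k γ uh qh) (hT : 0 < T) :
    ∀ t ∈ Icc 0 T, (fun x => dt T uh x t) ∈ m.dgSpace k := fun _ ht =>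
  m.dt_mem_dgSpace hT h.mem_u (fun j _ hx => h.differentiableOn j hx) ht

theorem Mesh.IsDGSolution.dt_dt_mem (h : m.IsDGSolution T δ k γ uh qh) (hT : 0 < T) :
    ∀ t ∈ Icc 0 T, (fun x => dt T (dt T uh) x t) ∈ m.dgSpace k := fun _ ht =>
  m.dt_mem_dgSpace hT (h.dt_mem hT) (fun j _ hx => h.differentiableOn_dt hT j hx) ht

theorem integral_mul_eq_zero_of_orthogonal (hab : a < b) {f g : ℝ → ℝ} (hf : MemLp f ⊤ volume)
    (hg : g ∈ m.dgSpace k)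
    (h : ∀ j, ∀ p : Polynomial ℝ, p.natDegree ≤ k →
      ∫ x in (m.left j)..(m.right j), f x * p.eval x = 0) :
    ∫ x in a..b, f x * g x = 0 := by
  have hint : IntervalIntegrable (fun x => f x * g x) volume a b :=
    intervalIntegrable_of_memLp_top (memLp_top_mul hf (m.memLp_top_of_mem_dgSpace hab hg)) a b
  rw [← m.sum_integral_cell hint]
  refine Finset.sum_eq_zero fun j _ => ?_
  obtain ⟨p, hp, hpe⟩ := hg.2 j
  rw [← h j p hp]
  exact integral_congr_of_eqOn_Ioo (m.left_lt_right j).le fun x hx => by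
    simp only [hpe x hx]

/-- Differentiability of `u_h` in time is known only inside the cells, so the derivative of the
difference splits almost everywhere. -/
theorem l2Norm_dt_sub_sq (hab : a < b) (hT : 0 < T) (h : m.IsDGSolution T δ k γ uh qh)
    (hu : ContDiffOn ℝ 1 (fun p : ℝ × ℝ => u p.1 p.2) (univ ×ˢ Icc 0 T)) {t : ℝ}
    (ht : t ∈ Icc 0 T) :
    l2Norm a b (fun x => dt T (fun y τ => uh y τ - u y τ) x t) ^ 2
      = ∫ x in a..b, (dt T uh x t - dt T u x t) ^ 2 := by
  rw [l2Norm_sq hab.le, intervalIntegral.integral_of_le hab.le,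
    intervalIntegral.integral_of_le hab.le, integral_Ioc_eq_integral_Ioo,
    integral_Ioc_eq_integral_Ioo]
  refine integral_congr_ae ?_
  filter_upwards [ae_restrict_mem measurableSet_Ioo,
    ae_restrict_of_ae (m.ae_wrap_notMem_range_node hab)] with x hx hn
  rw [m.wrap_of_mem hab (Ioo_subset_Ico_self hx)] at hn
  obtain ⟨j, hj⟩ := m.exists_mem_cell (Ioo_subset_Ico_self hx) hn
  have h1 := (hasDerivWithinAt_dt (h.differentiableOn j hj) ht).sub
    (hasDerivWithinAt_dt (differentiableOn_time hu x) ht)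
  rw [← h1.derivWithin (uniqueDiffOn_Icc hT t ht)]
  rfl

/-- The projection of the error and of its time derivative to `V_h^k` are of order `k + 1`. -/
theorem projected_error_le (hab : a < b) (hT : 0 < T) (hδ : 0 < δ) (hγ : ∀ s, 0 ≤ γ s)
    (hloc : LocallyIntegrable γ volume) {M : ℝ} (hM : 0 ≤ M)
    (hex : IsExactSolution a b T δ γ u q)
    (hu : ContDiffOn ℝ ((k + 2 : ℕ) : WithTop ℕ∞) (fun p : ℝ × ℝ => u p.1 p.2)
      (univ ×ˢ Icc 0 T))
    (hq : ∀ t ∈ Icc 0 T, ∀ s ∈ Ioc 0 δ,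
      hSeminorm a b (k + 1) (fun x => 1 / s * (u (x + s) t - u x t)) ≤ M)
    (hdg : m.IsDGSolution T δ k γ uh qh) (hinit : m.HasProjectedInitialData T k u uh)
    (hφ : m.IsOrthonormalBasis k φ) {G : ℝ} (hG : G = ∫ s in (0 : ℝ)..δ, γ s)
    {E : ℝ} (hE : E = 4 * G * M * (2 * (b - a) + δ) * m.size ^ (k + 1) *
      Real.exp ((1 + 8 * G) * T)) :
    ∀ t ∈ Icc 0 T, ∑ i, (∫ x in a..b, (uh x t - u x t) * φ i x) ^ 2 ≤ E ^ 2 ∧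
      ∑ i, (∫ x in a..b, (dt T uh x t - dt T u x t) * φ i x) ^ 2 ≤ E ^ 2 := by
  have hba : 0 < b - a := sub_pos.2 hab
  have hG0 : 0 ≤ G := hG ▸ intervalIntegral.integral_nonneg hδ.le fun s _ => hγ s
  have hsize := m.size_nonneg
  have hφt := hφ.memLp_top hab
  have hu2 : ContDiffOn ℝ ((1 + 1 : ℕ) : WithTop ℕ∞) (fun p : ℝ × ℝ => u p.1 p.2)
      (univ ×ˢ Icc 0 T) := hu.of_le (by exact_mod_cast by omega)
  have hu1 : ContDiffOn ℝ 1 (fun p : ℝ × ℝ => u p.1 p.2) (univ ×ˢ Icc 0 T) :=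
    hu2.of_le (by exact_mod_cast by omega)
  have hdu1 : ContDiffOn ℝ 1 (fun p : ℝ × ℝ => dt T u p.1 p.2) (univ ×ˢ Icc 0 T) := by
    simpa using contDiffOn_dt hT hu2
  have hddu : ContinuousOn (fun p : ℝ × ℝ => dt T (dt T u) p.1 p.2) (univ ×ˢ Icc 0 T) :=
    (contDiffOn_dt (n := 0) hT (by simpa using hdu1)).continuousOn
  have hper1 : ∀ t ∈ Icc 0 T, Function.Periodic (fun x => dt T u x t) (b - a) :=
    fun t ht => dt_periodic hex.periodic ht
  have htop : ∀ {U : ℝ → ℝ → ℝ}, ContinuousOn (fun p : ℝ × ℝ => U p.1 p.2) (univ ×ˢ Icc 0 T) →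
      (∀ t ∈ Icc 0 T, Function.Periodic (fun x => U x t) (b - a)) →
      ∀ t ∈ Icc 0 T, MemLp (fun x => U x t) ⊤ volume := fun hU hp t ht =>
    memLp_top_of_continuous_periodic hba (continuous_slice hU ht) (hp t ht)
  have hut := htop hu1.continuousOn hex.periodic
  have hdut := htop hdu1.continuousOn hper1
  have hddut := htop hddu fun t ht => dt_periodic hper1 ht
  have hint : ∀ {f g : ℝ → ℝ} (i : Fin n), MemLp f ⊤ volume → MemLp g ⊤ volume →
      ∫ x in a..b, (f x - g x) * φ i x
        = (∫ x in a..b, f x * φ i x) - ∫ x in a..b, g x * φ i x := by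
    intro f g i hf hg
    rw [← intervalIntegral.integral_sub
      (intervalIntegrable_of_memLp_top (memLp_top_mul hf (hφt i)) a b)
      (intervalIntegrable_of_memLp_top (memLp_top_mul hg (hφt i)) a b)]
    congr 1; ext x; ring
  have hdgt : ∀ {U : ℝ → ℝ → ℝ}, (∀ t ∈ Icc 0 T, (fun x => U x t) ∈ m.dgSpace k) →
      ∀ t ∈ Icc 0 T, MemLp (fun x => U x t) ⊤ volume := fun hU t ht =>
    m.memLp_top_of_mem_dgSpace hab (hU t ht)
  have huht := hdgt hdg.mem_u
  have hduht := hdgt (hdg.dt_mem hT)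
  have hdduht := hdgt (hdg.dt_dt_mem hT)
  have hcont : ∀ {U Uh : ℝ → ℝ → ℝ}, ContDiffOn ℝ 1 (fun p : ℝ × ℝ => U p.1 p.2)
        (univ ×ˢ Icc 0 T) → (∀ t ∈ Icc 0 T, (fun x => Uh x t) ∈ m.dgSpace k) →
      (∀ j, ∀ x ∈ m.cell j, DifferentiableOn ℝ (fun t => Uh x t) (Icc 0 T)) →
      (∀ t ∈ Icc 0 T, MemLp (fun x => U x t) ⊤ volume) → ∀ i,
      ContinuousOn (fun t => ∫ x in a..b, (Uh x t - U x t) * φ i x) (Icc 0 T) := by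
    intro U Uh hU hUh hd hUt i
    refine ContinuousOn.congr (f := fun t => (∫ x in a..b, Uh x t * φ i x)
      - ∫ x in a..b, U x t * φ i x) (ContinuousOn.sub (fun t ht => ?_)
        (continuousOn_integral_mul hab hU.continuousOn (hφt i)))
      fun t ht => hint i (hdgt hUh t ht) (hUt t ht)
    exact (m.hasDerivWithinAt_integral_mul hab hT hUh hd (hφt i) ht).continuousWithinAt
  have hderiv : ∀ {U Uh : ℝ → ℝ → ℝ}, ContDiffOn ℝ 1 (fun p : ℝ × ℝ => U p.1 p.2)
        (univ ×ˢ Icc 0 T) → (∀ t ∈ Icc 0 T, (fun x => Uh x t) ∈ m.dgSpace k) →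
      (∀ j, ∀ x ∈ m.cell j, DifferentiableOn ℝ (fun t => Uh x t) (Icc 0 T)) →
      (∀ t ∈ Icc 0 T, MemLp (fun x => U x t) ⊤ volume) →
      (∀ t ∈ Icc 0 T, MemLp (fun x => dt T U x t) ⊤ volume) → ∀ t ∈ Ioo 0 T, ∀ i,
      HasDerivAt (fun t => ∫ x in a..b, (Uh x t - U x t) * φ i x)
        (∫ x in a..b, (dt T Uh x t - dt T U x t) * φ i x) t := by
    intro U Uh hU hUh hd hUt hdUt t ht i
    have htI := Ioo_subset_Icc_self ht
    rw [hint i (m.memLp_top_of_mem_dgSpace hab (m.dt_mem_dgSpace hT hUh hd htI)) (hdUt t htI)]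
    refine HasDerivAt.congr_of_eventuallyEq
      (((m.hasDerivWithinAt_integral_mul hab hT hUh hd (hφt i) htI).hasDerivAt
        (Icc_mem_nhds ht.1 ht.2)).sub (hasDerivAt_integral_mul hab hT hU (hφt i) ht)) ?_
    filter_upwards [isOpen_Ioo.mem_nhds ht] with τ hτ
    exact hint i (hdgt hUh τ (Ioo_subset_Icc_self hτ)) (hUt τ (Ioo_subset_Icc_self hτ))
  have hd0 := fun j x (hx : x ∈ m.cell j) => hdg.differentiableOn j hx
  have hd1 := fun j x (hx : x ∈ m.cell j) => hdg.differentiableOn_dt hT j hx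
  set c : ℝ → EuclideanSpace ℝ (Fin n) := fun t =>
    WithLp.toLp 2 fun i => ∫ x in a..b, (uh x t - u x t) * φ i x with hc
  set d : ℝ → EuclideanSpace ℝ (Fin n) := fun t =>
    WithLp.toLp 2 fun i => ∫ x in a..b, (dt T uh x t - dt T u x t) * φ i x with hd
  set g : ℝ → EuclideanSpace ℝ (Fin n) := fun t =>
    WithLp.toLp 2 fun i => ∫ x in a..b, (dt T (dt T uh) x t - dt T (dt T u) x t) * φ i x with hg
  have hzero : (0 : ℝ) ∈ Icc 0 T := ⟨le_rfl, hT.le⟩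
  -- Since the initial data are `L²` projections, both initial errors are orthogonal to `V_h^k`.
  have hc0 : c 0 = 0 := by
    have : (fun i => ∫ x in a..b, (uh x 0 - u x 0) * φ i x) = 0 := by
      ext i
      refine integral_mul_eq_zero_of_orthogonal hab ((huht 0 hzero).sub (hut 0 hzero)) (hφ.mem i)
        fun j p hp => ?_
      refine neg_eq_zero.1 (Eq.trans ?_ (hinit.1.2 j p hp))
      rw [← intervalIntegral.integral_neg]
      congr 1; ext x; ring
    simp only [hc, this, WithLp.toLp_zero]
  have hd00 : d 0 = 0 := by
    have : (fun i => ∫ x in a..b, (dt T uh x 0 - dt T u x 0) * φ i x) = 0 := by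
      ext i
      refine integral_mul_eq_zero_of_orthogonal hab ((hduht 0 hzero).sub (hdut 0 hzero)) (hφ.mem i)
        fun j p hp => ?_
      refine neg_eq_zero.1 (Eq.trans ?_ (hinit.2 j p hp))
      rw [← intervalIntegral.integral_neg]
      congr 1; ext x; ring
    simp only [hd, this, WithLp.toLp_zero]
  have hnorm : ∀ f : Fin n → ℝ, ‖WithLp.toLp 2 f‖ ^ 2 = ∑ i, f i ^ 2 := fun f => by
    rw [EuclideanSpace.norm_sq_eq]; simp
  -- This is `4 (2 A + δ B) G` with `A = ‖c‖ + h^(k+1) (b - a) M` and `B = h^(k+1) M`. The extra `1`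
  -- in the rate only ensures the `K ≥ 1` required by Grönwall.
  have hgb : ∀ t ∈ Ioo 0 T, ‖g t‖ ≤ (1 + 8 * G) * ‖c t‖
      + 4 * G * M * (2 * (b - a) + δ) * m.size ^ (k + 1) := by
    intro t ht
    have htI := Ioo_subset_Icc_self ht
    have hUc := contDiff_slice hu htI
    have hQ := fun s hs => hdg.mem_q t htI s hs
    have he := isControlledFamily_error (Q := fun s x => qh x t s) hab hδ hφ hsize hUc
      (hex.periodic t htI) (hdg.mem_u t htI) hQ (fun s hs j w hw => hdg.aux t htI s hs j w hw)
      (norm_nonneg (c t)) hM (hnorm _).symm.le (hq t htI)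
    have h := norm_acceleration_le hab hδ hφ hγ hloc hUc.continuous (hex.periodic t htI) he
      (hdduht t htI) (hddut t htI) (fun j r hr => hdg.wave t ht j r hr) fun x hx => by
        have hxw := hex.wave t ht x hx
        rw [intervalIntegral.integral_of_le hδ.le] at hxw ⊢
        refine Eq.trans ?_ hxw
        congr 2
        refine setIntegral_congr_fun measurableSet_Ioc fun s hs => ?_
        rw [sub_eq_zero.1 (hex.aux t htI s hs x), sub_eq_zero.1 (hex.aux t htI s hs (x - s))]
    rw [← hG] at h
    refine h.trans ?_
    have := norm_nonneg (c t)
    nlinarith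
  have hmain := norm_le_of_second_order_bound (c := c) (d := d) (g := g) (T := T)
    (K := 1 + 8 * G) (ε := 4 * G * M * (2 * (b - a) + δ) * m.size ^ (k + 1))
    (by linarith) (by positivity)
    (continuousOn_toLp fun i => hcont hu1 hdg.mem_u hd0 hut i)
    (continuousOn_toLp fun i => hcont hdu1 (hdg.dt_mem hT) hd1 hdut i)
    (fun t ht => hasDerivAt_toLp fun i => hderiv hu1 hdg.mem_u hd0 hut hdut t ht i)
    (fun t ht => hasDerivAt_toLp fun i => hderiv hdu1 (hdg.dt_mem hT) hd1 hdut hddut t ht i)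
    hc0 hd00 hgb
  intro t ht
  obtain ⟨h1, h2⟩ := hmain t ht
  rw [← hE] at h1 h2
  exact ⟨(hnorm _).symm.le.trans (pow_le_pow_left₀ (norm_nonneg _) h1 2),
    (hnorm _).symm.le.trans (pow_le_pow_left₀ (norm_nonneg _) h2 2)⟩

end NonlocalDG

/-! ### The error estimate -/

theorem theorem3p1 (a b T δ ν : ℝ) (hab : a < b) (hT : 0 < T) (hδ : 0 < δ) (hν : 0 < ν)
    (k : ℕ) (γ : ℝ → ℝ) (hγ : NonlocalDG.KernelCondition δ γ)
    (hloc : MeasureTheory.LocallyIntegrable γ MeasureTheory.volume) (M : ℝ) :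
    ∃ C : ℝ, 0 < C ∧
      ∀ (u : ℝ → ℝ → ℝ) (q : ℝ → ℝ → ℝ → ℝ),
        NonlocalDG.IsExactSolution a b T δ γ u q →
        ContDiffOn ℝ ((k + 2 : ℕ) : WithTop ℕ∞) (fun p : ℝ × ℝ => u p.1 p.2)
          (Set.univ ×ˢ Set.Icc 0 T) →
        (∀ t ∈ Set.Icc 0 T,
          NonlocalDG.hSeminorm a b (k + 1) (fun x => NonlocalDG.dt T u x t) ≤ M) →
        (∀ t ∈ Set.Icc 0 T, ∀ s ∈ Set.Ioc 0 δ,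
          NonlocalDG.hSeminorm a b (k + 1) (fun x => q x t s) ≤ M) →
        ∀ m : NonlocalDG.Mesh a b, m.IsRegular ν →
        ∀ (uh : ℝ → ℝ → ℝ) (qh : ℝ → ℝ → ℝ → ℝ),
          m.IsDGSolution T δ k γ uh qh →
          m.HasProjectedInitialData T k u uh →
          ∀ t ∈ Set.Icc 0 T,
            MeasureTheory.IntegrableOn
              (fun s => s ^ 2 * γ s * NonlocalDG.l2Norm a b (fun x => qh x t s - q x t s) ^ 2)
              (Set.Ioc 0 δ) MeasureTheory.volume ∧
            1 / 2 * NonlocalDG.l2Norm a b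
                (fun x => NonlocalDG.dt T (fun y τ => uh y τ - u y τ) x t) ^ 2
              + ∫ s in (0 : ℝ)..δ, s ^ 2 * γ s *
                  NonlocalDG.l2Norm a b (fun x => qh x t s - q x t s) ^ 2
              ≤ C * m.size ^ (2 * k + 2) := by
  have hba : 0 < b - a := sub_pos.2 hab
  set G : ℝ := ∫ s in (0 : ℝ)..δ, γ s with hG
  have hG0 : 0 ≤ G := intervalIntegral.integral_nonneg hδ.le fun s _ => hγ.nonneg s
  set E : ℝ := 4 * G * |M| * (2 * (b - a) + δ) * Real.exp ((1 + 8 * G) * T) with hE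
  have hE0 : 0 ≤ E := by positivity
  -- The second term comes from the velocity error, the third from the weighted flux error, each as
  -- projected part plus approximation error. The `1` makes the constant positive, and `|M|` stands
  -- in for `M`, whose sign is free.
  refine ⟨1 + 1 / 2 * (E + |M|) ^ 2 + (2 * (E + (b - a) * |M|) + δ * |M|) ^ 2 * G, by positivity, ?_⟩
  intro u q hex hu hut hq m _ uh qh hdg hinit t ht
  obtain ⟨n, φ, hφ⟩ := m.exists_isOrthonormalBasis hab k
  have hsize := m.size_nonneg
  have hqe : ∀ τ ∈ Set.Icc 0 T, ∀ s ∈ Set.Ioc 0 δ, ∀ x,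
      q x τ s = 1 / s * (u (x + s) τ - u x τ) := fun τ hτ s hs x =>
    sub_eq_zero.1 (hex.aux τ hτ s hs x)
  have hq' : ∀ τ ∈ Set.Icc 0 T, ∀ s ∈ Set.Ioc 0 δ,
      NonlocalDG.hSeminorm a b (k + 1) (fun x => 1 / s * (u (x + s) τ - u x τ)) ≤ |M| := by
    intro τ hτ s hs
    have := hq τ hτ s hs
    simp only [hqe τ hτ s hs] at this
    exact this.trans (le_abs_self M)
  have hu1 : ContDiffOn ℝ ((k + 1 + 1 : ℕ) : WithTop ℕ∞) (fun p : ℝ × ℝ => u p.1 p.2)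
      (Set.univ ×ˢ Set.Icc 0 T) := hu
  have hdu := NonlocalDG.contDiffOn_dt hT hu1
  obtain ⟨h1, h2⟩ := NonlocalDG.projected_error_le hab hT hδ hγ.nonneg hloc (abs_nonneg M) hex hu hq'
    hdg hinit hφ hG (E := E * m.size ^ (k + 1)) (by rw [hE]; ring) t ht
  have he := NonlocalDG.isControlledFamily_error (Q := fun s x => qh x t s) hab hδ hφ hsize
    (NonlocalDG.contDiff_slice hu ht) (hex.periodic t ht) (hdg.mem_u t ht)
    (fun s hs => hdg.mem_q t ht s hs) (fun s hs j w hw => hdg.aux t ht s hs j w hw)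
    (by positivity) (abs_nonneg M) h1 (hq' t ht)
  have hvel := NonlocalDG.integral_sub_sq_le_add_sq hab hφ (hdg.dt_mem hT t ht)
    (NonlocalDG.contDiff_slice hdu ht) (NonlocalDG.dt_periodic hex.periodic ht)
    (by positivity) (abs_nonneg M) h2
    (NonlocalDG.integral_sq_le_of_hSeminorm_le hab.le ((hut t ht).trans (le_abs_self M))) hsize
  have hnorm : ∀ s ∈ Set.Ioc 0 δ,
      s ^ 2 * γ s * ∫ x in a..b, (qh x t s - 1 / s * (u (x + s) t - u x t)) ^ 2
        = s ^ 2 * γ s * NonlocalDG.l2Norm a b (fun x => qh x t s - q x t s) ^ 2 := fun s hs => by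
    rw [NonlocalDG.l2Norm_sq hab.le]
    simp only [hqe t ht s hs]
  refine ⟨(he.integrableOn_integral_sq hab hγ.nonneg hloc).congr_fun hnorm measurableSet_Ioc, ?_⟩
  have hflux : ∫ s in (0 : ℝ)..δ, s ^ 2 * γ s *
      NonlocalDG.l2Norm a b (fun x => qh x t s - q x t s) ^ 2
      = ∫ s in (0 : ℝ)..δ, s ^ 2 * γ s *
        ∫ x in a..b, (qh x t s - 1 / s * (u (x + s) t - u x t)) ^ 2 := by
    rw [intervalIntegral.integral_of_le hδ.le, intervalIntegral.integral_of_le hδ.le]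
    exact (MeasureTheory.setIntegral_congr_fun measurableSet_Ioc hnorm).symm
  have hflux_le := he.integral_integral_sq_le hab hδ hγ.nonneg hloc
  rw [hflux, NonlocalDG.l2Norm_dt_sub_sq hab hT hdg
    (hu.of_le (by exact_mod_cast by omega)) ht]
  rw [← hG] at hflux_le
  have e1 : (E * m.size ^ (k + 1) + m.size ^ (k + 1) * |M|) ^ 2
      = (E + |M|) ^ 2 * m.size ^ (2 * k + 2) := by ring
  have e2 : (2 * (E * m.size ^ (k + 1) + m.size ^ (k + 1) * ((b - a) * |M|))
      + δ * (m.size ^ (k + 1) * |M|)) ^ 2 * G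
      = (2 * (E + (b - a) * |M|) + δ * |M|) ^ 2 * G * m.size ^ (2 * k + 2) := by ring
  rw [e1] at hvel
  rw [e2] at hflux_le
  have hpos : 0 ≤ m.size ^ (2 * k + 2) := by positivity
  linarith
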